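/- Let $\mathbb Y$ be a Polish space with its Borel $\sigma$-field, $\mathcal L$ a measure on $\mathbb Y$, and let $\theta=(\nu,f_1,f_2)$ consist of a probability vector $\nu=(\nu_1,\nu_2)$ and two probability densities $f_1,f_2$ with respect to $\mathcal L$. Let $(X_i,Y_i)_{1\le i\le n}$, $n\ge 1$, be i.i.d. with $\mathbb P_\theta(X_i=x)=\nu_x$ and $Y_i\mid X_i=x\sim f_x\,d\mathcal L$ (this is the hidden Markov model with $J=2$ states whose transition matrix has both rows equal to the initial distribution $\nu$). A classifier is a measurable map $h:\mathbb Y^n\to\{1,2\}^n$; its risk is $\mathcal R_n^{\mathrm{class}}(\theta,h)=\mathbb E_\theta\big[\frac1n\sum_{i=1}^n\mathbf 1_{h_i(Y_{1:n})\ne X_i}\big]$. A clusterer is a measurable map $g$ from $\mathbb Y^n$ to the set of partitions of $[n]=\{1,\dots,n\}$; its risk is $\mathcal R_n^{\mathrm{clust}}(\theta,g)=\mathbb E_\theta[\ell(g(Y_{1:n}),\Pi_n)]$, where $\Pi_n$ is the partition of $[n]$ into the classes of the relation $X_i=X_j$, and for two partitions $A,B$ of $[n]$ $$\ell(A,B)=1-\frac1n\max_{M}\sum_{(C,C')\in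 M}\mathrm{Card}(C\cap C'),$$ the maximum being over the matchings $M$ of the complete bipartite graph between the blocks of $A$ and the blocks of $B$. Let $R^{\mathrm{class}}_n(\theta)=\inf_h\mathcal R_n^{\mathrm{class}}(\theta,h)$ and $R^{\mathrm{clust}}_n(\theta)=\inf_g\mathcal R_n^{\mathrm{clust}}(\theta,g)$ be the two Bayes risks and $\varepsilon=\varepsilon_{n,\theta}=\frac12-R^{\mathrm{class}}_n(\theta)$. Below, a quotient with numerator $1$ and denominator $0$ (the case $\varepsilon=0$) is $+\infty$, and for $\varepsilon=\frac12$ the quotient is $0$. 1. For every $\theta$ and every $n\ge2$: $R^{\mathrm{class}}_n(\theta)=0$ if and only if $R^{\mathrm{clust}}_n(\theta)=0$. 2. For every $\theta$ and every $n\ge1$ with $R^{\mathrm{class}}_n(\theta)\ne0$, $$R^{\mathrm{class}}_n(\theta)-R^{\mathrm{clust}}_n(\theta)\le\min\Bigg(\frac{(1-4\varepsilon^2)^{n/2}}{\frac n2\log\big(\frac{1+2\varepsilon}{1-2\varepsilon}\big)},\ \sqrt{\frac{\pi}{2n}}\Bigg).$$ 3. There is a universal constant $B>0$ such that for all $n\ge100$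 and all $\theta$ (and all $\mathbb Y,\mathcal L$), $$R^{\mathrm{class}}_n(\theta)-R^{\mathrm{clust}}_n(\theta)\ge B\min\Bigg(\frac{(1-4\varepsilon^2)^{\frac n2\left(1+\frac{6.8}{\max(1,\sqrt n\,\varepsilon)}\right)}}{\frac n2\log\big(\frac{1+2\varepsilon}{1-2\varepsilon}\big)},\ \frac1{\sqrt n}\Bigg).$$ -/

import Mathlib

open MeasureTheory
open scoped NNReal ENNReal

universe u

noncomputable section

/-- Parameters of a hidden Markov model with `J` hidden states (labelled by `Fin J`) and
observations in `𝕐`: the initial distribution `ν`, the transition matrix `Q` (each row is a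
probability vector), and the emission densities `f x` with respect to the dominating
measure `L`. -/
structure HMMParam (J : ℕ) (𝕐 : Type*) [MeasurableSpace 𝕐] (L : Measure 𝕐) where
  ν : PMF (Fin J)
  Q : Fin J → PMF (Fin J)
  f : Fin J → 𝕐 → ℝ≥0
  measurable_f : ∀ x, Measurable (f x)
  lintegral_f : ∀ x, ∫⁻ y, (f x y : ℝ≥0∞) ∂L = 1

namespace HMMParam

variable {J : ℕ} {𝕐 : Type*} [MeasurableSpace 𝕐] {L : Measure 𝕐}

/-- The independent case: all the rows of the transition matrix are equal to `ν`. -/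
def IsIndependent (θ : HMMParam J 𝕐 L) : Prop := ∀ x, θ.Q x = θ.ν

/-- The emission distribution of state `x`. -/
def emission (θ : HMMParam J 𝕐 L) (x : Fin J) : Measure 𝕐 :=
  L.withDensity fun y => (θ.f x y : ℝ≥0∞)

instance (θ : HMMParam J 𝕐 L) (x : Fin J) : IsProbabilityMeasure (θ.emission x) :=
  ⟨by simp [emission, θ.lintegral_f x]⟩

/-- The probability `ν(x₁) Q(x₁, x₂) ⋯ Q(xₙ₋₁, xₙ)` of the path `x` of the hidden chain. -/
def pathProb (θ : HMMParam J 𝕐 L) {n : ℕ} (x : Fin n → Fin J) : ℝ≥0∞ :=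
  ∏ i : Fin n,
    if (i : ℕ) = 0 then θ.ν (x i)
    else θ.Q (x ⟨(i : ℕ) - 1, (Nat.sub_le _ _).trans_lt i.isLt⟩) (x i)

/-- The joint law of `(X₁, …, Xₙ)` and `(Y₁, …, Yₙ)`: the hidden path `x` has probability
`pathProb θ x` and, given the path, the observations are independent, the `i`-th one having the
emission distribution of the state `x i`. -/
def law (θ : HMMParam J 𝕐 L) (n : ℕ) : Measure ((Fin n → Fin J) × (Fin n → 𝕐)) :=
  ∑ x : Fin n → Fin J,
    θ.pathProb x • (Measure.dirac x).prod (Measure.pi fun i => θ.emission (x i))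

end HMMParam

/-- The partition of `[n]` into the level sets of the label vector `x`. -/
def labelPartition {n J : ℕ} (x : Fin n → Fin J) : Finpartition (Finset.univ : Finset (Fin n)) :=
  letI : DecidableRel (Setoid.ker x).r := fun i j => inferInstanceAs (Decidable (x i = x j))
  Finpartition.ofSetoid (Setoid.ker x)

/-- `M` is a matching in the complete bipartite graph on the blocks of `A` and the blocks of `B`:
a set of edges, no two of which share a vertex. -/
def IsBlockMatching {n : ℕ} (A B : Finpartition (Finset.univ : Finset (Fin n)))
    (M : Finset (Finset (Fin n) × Finset (Fin n))) : Prop :=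
  M ⊆ A.parts ×ˢ B.parts ∧
    ∀ e ∈ M, ∀ e' ∈ M, e ≠ e' → e.1 ≠ e'.1 ∧ e.2 ≠ e'.2

open Classical in
/-- The largest total overlap of a matching between the blocks of `A` and those of `B`. -/
def maxOverlap {n : ℕ} (A B : Finpartition (Finset.univ : Finset (Fin n))) : ℕ :=
  ((A.parts ×ˢ B.parts).powerset.filter (IsBlockMatching A B)).sup
    fun M => ∑ e ∈ M, (e.1 ∩ e.2).card

/-- The misclassification error distance between two partitions of `[n]`. -/
def clusterLoss {n : ℕ} (A B : Finpartition (Finset.univ : Finset (Fin n))) : ℝ :=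
  1 - (1 / (n : ℝ)) * (maxOverlap A B : ℝ)

/-- An `n`-clusterer: a measurable map from `𝕐ⁿ` to the (finite, discrete) set of partitions
of `[n]`. -/
def Clusterer (n : ℕ) (𝕐 : Type*) [MeasurableSpace 𝕐] : Type _ :=
  {g : (Fin n → 𝕐) → Finpartition (Finset.univ : Finset (Fin n)) //
    ∀ A : Finpartition (Finset.univ : Finset (Fin n)), MeasurableSet (g ⁻¹' {A})}

/-- An `n`-classifier: a measurable map from `𝕐ⁿ` to the set of label vectors. -/
def Classifier (n J : ℕ) (𝕐 : Type*) [MeasurableSpace 𝕐] : Type _ :=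
  {h : (Fin n → 𝕐) → (Fin n → Fin J) // Measurable h}

namespace HMMParam

variable {J : ℕ} {𝕐 : Type*} [MeasurableSpace 𝕐] {L : Measure 𝕐}

/-- The risk of clustering of `g`: the expected loss of `g(Y)` with respect to the partition
induced by the hidden labels. -/
def clustRisk (θ : HMMParam J 𝕐 L) (n : ℕ) (g : Clusterer n 𝕐) : ℝ :=
  ∫ z, clusterLoss (g.1 z.2) (labelPartition z.1) ∂(θ.law n)

/-- The risk of classification of `h`: the expected proportion of misclassified observations. -/
def classRisk (θ : HMMParam J 𝕐 L) (n : ℕ) (h : Classifier n J 𝕐) : ℝ :=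
  ∫ z, (1 / (n : ℝ)) * ∑ i : Fin n, (if h.1 z.2 i ≠ z.1 i then (1 : ℝ) else 0) ∂(θ.law n)

/-- The Bayes risk of clustering. -/
def bayesClustRisk (θ : HMMParam J 𝕐 L) (n : ℕ) : ℝ :=
  ⨅ g : Clusterer n 𝕐, θ.clustRisk n g

/-- The Bayes risk of classification. -/
def bayesClassRisk (θ : HMMParam J 𝕐 L) (n : ℕ) : ℝ :=
  ⨅ h : Classifier n J 𝕐, θ.classRisk n h

/-- `ε = 1/2 - (Bayes risk of classification)`. -/
def eps (θ : HMMParam J 𝕐 L) (n : ℕ) : ℝ := 1 / 2 - θ.bayesClassRisk n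

end HMMParam

end

/-! Given the observations, the labels are independent and the sign of the i-th label has mean m_i =
`contrast` (Y_i). The best classifier reads off the sign of each m_i, and its risk is (1 - δ)/2 with
δ = E|m| (`meanContrast`), so δ = 2ε.

The level sets of that classifier are also an optimal clustering, for two reasons. More than two
blocks do not help: splitting off the block of a uniform random index does, on average, at least as
well as any matching (`pair_le_sum_abs`). Among two-block splits, the mean of |∑ ±X_i| is largest
when every sign agrees with m_i (`prodExp_abs_le`), which is an induction over a cone of functions
stable under steps with nonnegative drift (`DriftPositive.prodExp_nonneg`). The optimal conditional
risk is 1/2 - E|S|/(2n), where S is a sum of independent signs of means |m_i|. It is multilinear in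
the |m_i|, so integrating over the independent observations replaces each of them by δ. Hence the
gap between the risks is E[S⁻]/n for a sum S of n i.i.d. signs of mean δ
(`bayesClassRisk_sub_bayesClustRisk`).

It remains to estimate E[S⁻]. With λ = log((1+δ)/(1-δ))/2 and δ < 1, tilting gives E φ(S) =
(1-δ²)^(n/2) E₀[e^(λS) φ(S)], with E₀ for the symmetric walk (`walkExp_tilt`). From above, S⁻ ≤
e^(-λS)/λ gives the exponential bound and the variance gives √n/2. From below, on S ≥ -4√n the
factor e^(λS) is at least e^(-4λ√n), and second and fourth moments leave a truncated negative part
of mean at least √n/36. The loss 4λ√n is bounded when √n δ ≤ 2 (`small_drift_exponent_ge`), and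
otherwise goes into the 6.8 correction (`mul_log_ratio_le`). -/

noncomputable section

/-! ### Signs and expectations under product weights -/

/-- The sign attached to a label in `Fin 2`. -/
def labelSign (c : Fin 2) : ℝ := if c = 0 then 1 else -1

@[simp] lemma labelSign_zero : labelSign 0 = 1 := by simp [labelSign]

@[simp] lemma labelSign_one : labelSign 1 = -1 := by simp [labelSign]

lemma labelSign_add (c d : Fin 2) : labelSign (c + d) = labelSign c * labelSign d := by
  fin_cases c <;> fin_cases d <;> simp [labelSign]

@[simp] lemma labelSign_mul_self (c : Fin 2) : labelSign c * labelSign c = 1 := by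
  fin_cases c <;> simp

@[simp] lemma abs_labelSign (c : Fin 2) : |labelSign c| = 1 := by
  fin_cases c <;> simp

/-- The law on labels whose sign has mean `m`. -/
def signWeight (m : ℝ) (c : Fin 2) : ℝ := (1 + m * labelSign c) / 2

lemma signWeight_nonneg {m : ℝ} (hm : |m| ≤ 1) (c : Fin 2) : 0 ≤ signWeight m c := by
  have := abs_le.1 hm
  fin_cases c <;> simp [signWeight] <;> linarith

lemma signWeight_le_one {m : ℝ} (hm : |m| ≤ 1) (c : Fin 2) : signWeight m c ≤ 1 := by
  have := abs_le.1 hm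
  fin_cases c <;> simp [signWeight] <;> linarith

lemma sum_signWeight (m : ℝ) : ∑ c, signWeight m c = 1 := by
  simp [signWeight]; ring

lemma signWeight_add (m : ℝ) (c d : Fin 2) :
    signWeight m (c + d) = signWeight (labelSign d * m) c := by
  simp only [signWeight, labelSign_add]; ring

/-- The expectation of `F` under the product of the weights `w i`. -/
def prodExp {n : ℕ} (w : Fin n → Fin 2 → ℝ) (F : (Fin n → Fin 2) → ℝ) : ℝ :=
  ∑ x, (∏ i, w i (x i)) * F x

section prodExp

variable {n : ℕ}

lemma prodExp_zero (w : Fin 0 → Fin 2 → ℝ) (F : (Fin 0 → Fin 2) → ℝ) :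
    prodExp w F = F default := by
  simp only [prodExp, Fintype.sum_unique, Finset.univ_eq_empty, Finset.prod_empty, one_mul]
  exact congrArg F (Subsingleton.elim _ _)

lemma prodExp_succ (w : Fin (n + 1) → Fin 2 → ℝ) (F : (Fin (n + 1) → Fin 2) → ℝ) :
    prodExp w F = w 0 0 * prodExp (fun i => w i.succ) (fun x => F (Fin.cons 0 x)) +
      w 0 1 * prodExp (fun i => w i.succ) (fun x => F (Fin.cons 1 x)) := by
  unfold prodExp
  rw [← (Fin.consEquiv fun _ => Fin 2).sum_comp, Fintype.sum_prod_type, Fin.sum_univ_two]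
  simp only [Fin.consEquiv, Equiv.coe_fn_mk, Fin.prod_univ_succ, Fin.cons_zero, Fin.cons_succ,
    Finset.mul_sum]
  simp only [mul_assoc]

lemma prodExp_add (w : Fin n → Fin 2 → ℝ) (F G : (Fin n → Fin 2) → ℝ) :
    prodExp w (fun x => F x + G x) = prodExp w F + prodExp w G := by
  simp [prodExp, mul_add, Finset.sum_add_distrib]

lemma prodExp_sub (w : Fin n → Fin 2 → ℝ) (F G : (Fin n → Fin 2) → ℝ) :
    prodExp w (fun x => F x - G x) = prodExp w F - prodExp w G := by
  simp [prodExp, mul_sub, Finset.sum_sub_distrib]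

lemma prodExp_const_mul (w : Fin n → Fin 2 → ℝ) (a : ℝ) (F : (Fin n → Fin 2) → ℝ) :
    prodExp w (fun x => a * F x) = a * prodExp w F := by
  simp only [prodExp, Finset.mul_sum]
  exact Finset.sum_congr rfl fun x _ => by ring

lemma prodExp_sum {ι : Type*} (s : Finset ι) (w : Fin n → Fin 2 → ℝ)
    (F : ι → (Fin n → Fin 2) → ℝ) :
    prodExp w (fun x => ∑ k ∈ s, F k x) = ∑ k ∈ s, prodExp w (F k) := by
  simp only [prodExp, Finset.mul_sum]
  exact Finset.sum_comm

lemma prodExp_const {w : Fin n → Fin 2 → ℝ} (hw : ∀ i, ∑ c, w i c = 1) (a : ℝ) :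
    prodExp w (fun _ => a) = a := by
  simp only [prodExp, ← Finset.sum_mul]
  have := Finset.prod_univ_sum (fun _ : Fin n => (Finset.univ : Finset (Fin 2))) w
  simp only [hw, Finset.prod_const_one, Fintype.piFinset_univ] at this
  rw [← this, one_mul]

lemma prodExp_mono {w : Fin n → Fin 2 → ℝ} (hw : ∀ i c, 0 ≤ w i c)
    {F G : (Fin n → Fin 2) → ℝ} (h : ∀ x, F x ≤ G x) : prodExp w F ≤ prodExp w G :=
  Finset.sum_le_sum fun x _ =>
    mul_le_mul_of_nonneg_left (h x) (Finset.prod_nonneg fun i _ => hw i (x i))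

lemma prodExp_apply {w : Fin n → Fin 2 → ℝ} (hw : ∀ i, ∑ c, w i c = 1) (j : Fin n)
    (φ : Fin 2 → ℝ) : prodExp w (fun x => φ (x j)) = ∑ c, w j c * φ c := by
  have := Finset.prod_univ_sum (fun _ : Fin n => (Finset.univ : Finset (Fin 2)))
    (fun i c => w i c * if i = j then φ c else 1)
  simp only [Finset.prod_mul_distrib, Fintype.piFinset_univ, Finset.prod_ite_eq',
    Finset.mem_univ, if_true] at this
  rw [prodExp, ← this, Finset.prod_eq_single j]
  · simp
  · intro i _ hij; simp [hij, hw]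
  · simp

lemma prodExp_labelSign (m : Fin n → ℝ) (j : Fin n) :
    prodExp (fun i => signWeight (m i)) (fun x => labelSign (x j)) = m j := by
  rw [prodExp_apply (fun i => sum_signWeight _)]
  simp [signWeight]; ring

/-- Relabelling some coordinates negates their means. This is what makes all means nonnegative
later. -/
lemma prodExp_translate (m : Fin n → ℝ) (h : Fin n → Fin 2) (F : (Fin n → Fin 2) → ℝ) :
    prodExp (fun i => signWeight (m i)) F =
      prodExp (fun i => signWeight (labelSign (h i) * m i)) (fun x => F (x + h)) := by
  unfold prodExp
  rw [← Equiv.sum_comp (Equiv.addRight h) fun x => (∏ i, signWeight (m i) (x i)) * F x]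
  simp [signWeight_add]

end prodExp

/-! ### The best choice of signs for independent labels -/

/-- A cone of functions of two real variables that is stable under averaging over `±1` steps
with nonnegative drift in either variable, and whose members are nonnegative at the origin. -/
structure DriftPositive (F : ℝ → ℝ → ℝ) : Prop where
  supermodular : ∀ a a' b b', a ≤ a' → b ≤ b' → F a b' + F a' b ≤ F a b + F a' b'
  mono_right : ∀ a b b', b ≤ b' → F a b + F (-a) b ≤ F a b' + F (-a) b'
  mono_left : ∀ a a' b, a ≤ a' → F a b + F a (-b) ≤ F a' b + F a' (-b)
  nonneg : ∀ a b, 0 ≤ F a b + F (-a) b + F a (-b) + F (-a) (-b)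

namespace DriftPositive

variable {F : ℝ → ℝ → ℝ}

lemma swap (hF : DriftPositive F) : DriftPositive fun a b => F b a where
  supermodular a a' b b' ha hb := by
    have := hF.supermodular b b' a a' hb ha; linarith
  mono_right a b b' hb := hF.mono_left b b' a hb
  mono_left a a' b ha := hF.mono_right b a a' ha
  nonneg a b := by have := hF.nonneg b a; linarith

/-- A step of mean m is a mixture of a symmetric step and a deterministic upward one. The
symmetrized conditions survive because the excess of the upward step is controlled by the next
stronger condition of the cone. -/
lemma step_left (hF : DriftPositive F) {m : ℝ} (h0 : 0 ≤ m) (h1 : m ≤ 1) :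
    DriftPositive fun a b => (1 + m) / 2 * F (a + 1) b + (1 - m) / 2 * F (a - 1) b where
  supermodular a a' b b' ha hb := by
    have e1 := hF.supermodular (a + 1) (a' + 1) b b' (by linarith) hb
    have e2 := hF.supermodular (a - 1) (a' - 1) b b' (by linarith) hb
    nlinarith
  mono_right a b b' hb := by
    have e1 := hF.mono_right (a + 1) b b' hb
    have e2 := hF.mono_right (a - 1) b b' hb
    -- With weights (1+m)/2 on `e1` and (1-m)/2 on `e2`, what remains is m (F (-a+1) - F (-a-1)),
    -- whose growth in b is supermodularity.
    have e3 := hF.supermodular (-a - 1) (-a + 1) b b' (by linarith) hb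
    rw [show -(a + 1) = -a - 1 by ring] at e1
    rw [show -(a - 1) = -a + 1 by ring] at e2
    nlinarith
  mono_left a a' b ha := by
    have e1 := hF.mono_left (a + 1) (a' + 1) b (by linarith)
    have e2 := hF.mono_left (a - 1) (a' - 1) b (by linarith)
    nlinarith
  nonneg a b := by
    have e1 := hF.nonneg (a + 1) b
    have e2 := hF.nonneg (a - 1) b
    have e3 := hF.mono_left (-a - 1) (-a + 1) b (by linarith)
    rw [show -(a + 1) = -a - 1 by ring] at e1
    rw [show -(a - 1) = -a + 1 by ring] at e2
    nlinarith

lemma step_right (hF : DriftPositive F) {m : ℝ} (h0 : 0 ≤ m) (h1 : m ≤ 1) :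
    DriftPositive fun a b => (1 + m) / 2 * F a (b + 1) + (1 - m) / 2 * F a (b - 1) :=
  (hF.swap.step_left h0 h1).swap

/-- Averaging over one coordinate replaces F by another member of the cone, so by induction only the
value at the origin matters. -/
lemma prodExp_nonneg {n : ℕ} (m : Fin n → ℝ) (h0 : ∀ i, 0 ≤ m i) (h1 : ∀ i, m i ≤ 1)
    (h : Fin n → Fin 2) (hF : DriftPositive F) :
    0 ≤ prodExp (fun i => signWeight (m i)) fun x =>
      F (∑ i, if h i = 0 then labelSign (x i) else 0)
        (∑ i, if h i = 0 then 0 else labelSign (x i)) := by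
  induction n generalizing F with
  | zero =>
    have := hF.nonneg 0 0
    simp only [neg_zero] at this
    simp only [prodExp_zero, Finset.univ_eq_empty, Finset.sum_empty]
    linarith
  | succ n ih =>
    rw [prodExp_succ]
    simp only [Fin.sum_univ_succ, Fin.cons_zero, Fin.cons_succ]
    by_cases hh : h 0 = 0
    · have := ih (fun i => m i.succ) (fun i => h0 _) (fun i => h1 _) (fun i => h i.succ)
        (hF.step_left (h0 0) (h1 0))
      rw [prodExp_add, prodExp_const_mul, prodExp_const_mul] at this
      simpa only [hh, if_true, if_false, labelSign_zero, labelSign_one, zero_add,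
        add_comm (1 : ℝ), neg_add_eq_sub, signWeight, mul_one, mul_neg, ← sub_eq_add_neg] using this
    · have := ih (fun i => m i.succ) (fun i => h0 _) (fun i => h1 _) (fun i => h i.succ)
        (hF.step_right (h0 0) (h1 0))
      rw [prodExp_add, prodExp_const_mul, prodExp_const_mul] at this
      simpa only [hh, if_true, if_false, labelSign_zero, labelSign_one, zero_add,
        add_comm (1 : ℝ), neg_add_eq_sub, signWeight, mul_one, mul_neg, ← sub_eq_add_neg] using this

end DriftPositive

/-- Supermodularity comes from convexity of the absolute value; the three symmetrized expressions
vanish identically. -/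
lemma driftPositive_abs : DriftPositive fun a b => |a + b| - |a - b| where
  supermodular a a' b b' ha hb := by
    have key : ∀ {x y z w : ℝ}, x ≤ y → x ≤ z → y + z = x + w → |y| + |z| ≤ |x| + |w| := by
      intro x y z w h1 h2 h3
      rcases abs_cases x with h | h <;> rcases abs_cases y with h' | h' <;>
        rcases abs_cases z with h'' | h'' <;> rcases abs_cases w with h4 | h4 <;> linarith
    have e1 := key (x := a + b) (y := a + b') (z := a' + b) (w := a' + b')
      (by linarith) (by linarith) (by ring)
    have e2 := key (x := a - b') (y := a - b) (z := a' - b') (w := a' - b)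
      (by linarith) (by linarith) (by ring)
    linarith
  mono_right a b b' _ := by
    rw [show -a + b = -(a - b) by ring, show -a - b = -(a + b) by ring,
      show -a + b' = -(a - b') by ring, show -a - b' = -(a + b') by ring]
    simp only [abs_neg]; linarith
  mono_left a a' b _ := by
    simp only [← sub_eq_add_neg, sub_neg_eq_add]; linarith
  nonneg a b := by
    rw [show -a + b = -(a - b) by ring, show -a - b = -(a + b) by ring,
      show -a + -b = -(a + b) by ring, show -a - -b = -(a - b) by ring]
    simp only [abs_neg, ← sub_eq_add_neg, sub_neg_eq_add]; linarith

/-- Let a and b be the partial sums over the labels 0 and 1 of `h`. The two sides are the means of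
|a - b| and |a + b|. -/
lemma prodExp_abs_signed_le {n : ℕ} (m : Fin n → ℝ) (h0 : ∀ i, 0 ≤ m i) (h1 : ∀ i, m i ≤ 1)
    (h : Fin n → Fin 2) :
    prodExp (fun i => signWeight (m i)) (fun x => |∑ i, labelSign (h i) * labelSign (x i)|) ≤
      prodExp (fun i => signWeight (m i)) (fun x => |∑ i, labelSign (x i)|) := by
  have := driftPositive_abs.prodExp_nonneg m h0 h1 h
  rw [prodExp_sub, sub_nonneg] at this
  refine (le_of_eq ?_).trans (this.trans (le_of_eq ?_))
  · congr 1; ext x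
    rw [← Finset.sum_sub_distrib]
    congr 1
    refine Finset.sum_congr rfl fun i _ => ?_
    by_cases hh : h i = 0
    · simp [hh]
    · simp [Fin.eq_one_of_ne_zero _ hh]
  · congr 1; ext x
    rw [← Finset.sum_add_distrib]
    congr 1
    refine Finset.sum_congr rfl fun i _ => ?_
    by_cases hh : h i = 0 <;> simp [hh]

/-- The label of the sign of `m`. -/
def signLabel (m : ℝ) : Fin 2 := if 0 ≤ m then 0 else 1

lemma labelSign_signLabel_mul (m : ℝ) : labelSign (signLabel m) * m = |m| := by
  unfold signLabel
  split_ifs with h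
  · simp [abs_of_nonneg h]
  · simp [abs_of_neg (not_le.1 h)]

lemma prodExp_abs_signLabel {n : ℕ} (m : Fin n → ℝ) :
    prodExp (fun i => signWeight (m i))
      (fun x => |∑ i, labelSign (signLabel (m i)) * labelSign (x i)|) =
      prodExp (fun i => signWeight |m i|) (fun x => |∑ i, labelSign (x i)|) := by
  rw [prodExp_translate m (fun i => signLabel (m i))]
  simp only [labelSign_signLabel_mul, Pi.add_apply, labelSign_add]
  congr 1; ext x
  congr 1
  refine Finset.sum_congr rfl fun i _ => ?_
  linear_combination labelSign (x i) * labelSign_mul_self (signLabel (m i))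

lemma prodExp_abs_le {n : ℕ} (m : Fin n → ℝ) (hm : ∀ i, |m i| ≤ 1) (h : Fin n → Fin 2) :
    prodExp (fun i => signWeight (m i)) (fun x => |∑ i, labelSign (h i) * labelSign (x i)|) ≤
      prodExp (fun i => signWeight |m i|) (fun x => |∑ i, labelSign (x i)|) := by
  rw [prodExp_translate m (fun i => signLabel (m i))]
  simp only [labelSign_signLabel_mul]
  refine le_trans (le_of_eq ?_) (prodExp_abs_signed_le (fun i => |m i|) (fun i => abs_nonneg _) hm
    (fun i => h i + signLabel (m i)))
  congr 1; ext x
  congr 1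
  refine Finset.sum_congr rfl fun i _ => ?_
  simp only [Pi.add_apply, labelSign_add]; ring

/-! ### Matchings of blocks and sums of signs -/

section overlap

variable {n : ℕ}

lemma mem_part_labelPartition {x : Fin n → Fin 2} {i j : Fin n} :
    j ∈ (labelPartition x).part i ↔ x i = x j := by
  let : DecidableRel (Setoid.ker x).r := fun i j => inferInstanceAs (Decidable (x i = x j))
  exact Finpartition.mem_part_ofSetoid_iff_rel (s := Setoid.ker x)

lemma part_labelPartition (x : Fin n → Fin 2) (i : Fin n) :
    (labelPartition x).part i = Finset.univ.filter (fun j => x j = x i) := by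
  ext j
  rw [mem_part_labelPartition, Finset.mem_filter, eq_comm]
  simp

lemma mem_parts_labelPartition {x : Fin n → Fin 2} {S : Finset (Fin n)} :
    S ∈ (labelPartition x).parts ↔
      S.Nonempty ∧ ∃ c, S = Finset.univ.filter (fun j => x j = c) := by
  constructor
  · intro hS
    obtain ⟨i, hi⟩ := (labelPartition x).nonempty_of_mem_parts hS
    refine ⟨⟨i, hi⟩, x i, ?_⟩
    rw [← part_labelPartition, (labelPartition x).part_eq_of_mem hS hi]
  · rintro ⟨⟨i, hi⟩, c, rfl⟩
    have : x i = c := by simpa using hi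
    rw [← this, ← part_labelPartition]
    simp

lemma labelPartition_add_const (x : Fin n → Fin 2) (c : Fin 2) :
    labelPartition (fun i => x i + c) = labelPartition x := by
  ext S
  rw [mem_parts_labelPartition, mem_parts_labelPartition]
  refine and_congr_right fun _ => ⟨?_, ?_⟩
  · rintro ⟨d, rfl⟩
    exact ⟨d - c, by simp [eq_sub_iff_add_eq]⟩
  · rintro ⟨d, rfl⟩
    exact ⟨d + c, by simp⟩

lemma le_maxOverlap {A B : Finpartition (Finset.univ : Finset (Fin n))}
    {M : Finset (Finset (Fin n) × Finset (Fin n))} (hM : IsBlockMatching A B M) :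
    ∑ e ∈ M, (e.1 ∩ e.2).card ≤ maxOverlap A B := by
  classical
  unfold maxOverlap
  refine Finset.le_sup
    (f := fun M : Finset (Finset (Fin n) × Finset (Fin n)) => ∑ e ∈ M, (e.1 ∩ e.2).card) ?_
  simp only [Finset.mem_filter, Finset.mem_powerset]
  exact ⟨hM.1, hM⟩

lemma maxOverlap_le {A B : Finpartition (Finset.univ : Finset (Fin n))} {a : ℝ}
    (h : ∀ M, IsBlockMatching A B M → ((∑ e ∈ M, (e.1 ∩ e.2).card : ℕ) : ℝ) ≤ a) :
    (maxOverlap A B : ℝ) ≤ a := by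
  classical
  unfold maxOverlap
  have hne : ((A.parts ×ˢ B.parts).powerset.filter (IsBlockMatching A B)).Nonempty :=
    ⟨∅, by simp [IsBlockMatching]⟩
  obtain ⟨M, hM, hM'⟩ := Finset.exists_mem_eq_sup _ hne
    (fun M : Finset (Finset (Fin n) × Finset (Fin n)) => ∑ e ∈ M, (e.1 ∩ e.2).card)
  rw [hM']
  exact h M (Finset.mem_filter.1 hM).2

lemma sum_inter_card_matching {A B : Finpartition (Finset.univ : Finset (Fin n))}
    {M : Finset (Finset (Fin n) × Finset (Fin n))} (hM : IsBlockMatching A B M) :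
    ∑ e ∈ M, (e.1 ∩ e.2).card = (M.biUnion fun e => e.1 ∩ e.2).card := by
  symm
  refine Finset.card_biUnion fun e he e' he' hne => ?_
  have h1 := Finset.mem_product.1 (hM.1 he)
  have h2 := Finset.mem_product.1 (hM.1 he')
  have := A.disjoint h1.1 h2.1 (hM.2 e he e' he' hne).1
  exact (this.mono_left Finset.inter_subset_left).mono_right Finset.inter_subset_left

/-- Pair the c-level of `h` with the c-level of `x`, using only those c at which the labels agree
somewhere, so that no empty level enters the matching. -/
lemma card_agree_le_maxOverlap (h x : Fin n → Fin 2) :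
    (Finset.univ.filter fun i => h i = x i).card ≤
      maxOverlap (labelPartition h) (labelPartition x) := by
  classical
  set lev : (Fin n → Fin 2) → Fin 2 → Finset (Fin n) :=
    fun z c => Finset.univ.filter fun i => z i = c with hlev
  set M : Finset (Finset (Fin n) × Finset (Fin n)) :=
    (Finset.univ.filter fun i => h i = x i).image fun i => (lev h (h i), lev x (x i)) with hMdef
  have hM : IsBlockMatching (labelPartition h) (labelPartition x) M := by
    constructor
    · intro e he
      obtain ⟨i, hi, rfl⟩ := Finset.mem_image.1 he
      rw [Finset.mem_product, mem_parts_labelPartition, mem_parts_labelPartition]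
      exact ⟨⟨⟨i, by simp [hlev]⟩, _, rfl⟩, ⟨⟨i, by simp [hlev]⟩, _, rfl⟩⟩
    · intro e he e' he' hne
      obtain ⟨i, hi, rfl⟩ := Finset.mem_image.1 he
      obtain ⟨j, hj, rfl⟩ := Finset.mem_image.1 he'
      simp only [Finset.mem_filter, Finset.mem_univ, true_and] at hi hj
      have inj : ∀ z : Fin n → Fin 2, lev z (z i) = lev z (z j) → z i = z j := by
        intro z hz
        have : i ∈ lev z (z j) := hz ▸ (by simp [hlev])
        simpa [hlev] using this
      constructor
      · intro hc
        have := inj h hc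
        exact hne (by rw [← hi, ← hj, this])
      · intro hc
        have := inj x hc
        exact hne (by rw [hi, hj, this])
  refine le_trans ?_ (le_maxOverlap hM)
  rw [sum_inter_card_matching hM]
  refine Finset.card_le_card fun i hi => ?_
  rw [Finset.mem_biUnion]
  exact ⟨_, Finset.mem_image_of_mem _ hi, by simp [hlev]⟩

lemma card_agree_eq (h x : Fin n → Fin 2) :
    ((Finset.univ.filter fun i => h i = x i).card : ℝ) =
      (n + ∑ i, labelSign (h i) * labelSign (x i)) / 2 := by
  have key : ∀ i, (if h i = x i then (1 : ℝ) else 0) =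
      (1 + labelSign (h i) * labelSign (x i)) / 2 := by
    intro i
    generalize h i = a
    generalize x i = b
    fin_cases a <;> fin_cases b <;> norm_num
  rw [Finset.card_filter]
  push_cast
  simp only [key, ← Finset.sum_div, Finset.sum_add_distrib]
  simp

/-- Swapping the two labels of `h` leaves its partition unchanged and negates the sum; the better of
the two gives the absolute value. -/
lemma le_maxOverlap_labelPartition (h x : Fin n → Fin 2) :
    (n + |∑ i, labelSign (h i) * labelSign (x i)|) / 2 ≤
      (maxOverlap (labelPartition h) (labelPartition x) : ℝ) := by
  have h1 : ((Finset.univ.filter fun i => h i = x i).card : ℝ) ≤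
      maxOverlap (labelPartition h) (labelPartition x) := by
    exact_mod_cast card_agree_le_maxOverlap h x
  have h2 : ((Finset.univ.filter fun i => h i + 1 = x i).card : ℝ) ≤
      maxOverlap (labelPartition h) (labelPartition x) := by
    rw [← labelPartition_add_const h 1]
    exact_mod_cast card_agree_le_maxOverlap (fun i => h i + 1) x
  rw [card_agree_eq] at h1
  rw [card_agree_eq (fun i => h i + 1)] at h2
  simp only [labelSign_add, labelSign_one, mul_neg, mul_one, neg_mul, Finset.sum_neg_distrib] at h2
  rcases abs_cases (∑ i, labelSign (h i) * labelSign (x i)) with h | h <;> rw [h.1] <;> linarith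

/-- Comparison of one pair of disjoint blocks `P`, `Q` with the splits of the index set into one
block against the rest, averaged over the block of a uniform random index. -/
lemma pair_le_sum_abs (σ : Fin n → ℝ) (hσ : ∀ i, |σ i| ≤ 1)
    (A : Finpartition (Finset.univ : Finset (Fin n))) (P Q : Finset (Fin n))
    (hPQ : Disjoint P Q) (hP : ∀ i ∈ P, A.part i = P) (hQ : ∀ i ∈ Q, A.part i = Q) :
    (n : ℝ) * (∑ i ∈ P, σ i - ∑ i ∈ Q, σ i - (n - P.card - Q.card)) ≤
      ∑ i, |∑ k, (if k ∈ A.part i then σ k else -σ k)| := by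
  classical
  set R : Finset (Fin n) := (P ∪ Q)ᶜ with hR
  set sum : Finset (Fin n) → ℝ := fun S => ∑ i ∈ S, σ i with hsum
  have bound : ∀ S : Finset (Fin n), |sum S| ≤ S.card := by
    intro S
    refine (Finset.abs_sum_le_sum_abs _ _).trans ?_
    refine (Finset.sum_le_card_nsmul _ _ 1 fun i _ => hσ i).trans ?_
    simp
  have split : ∀ f : Fin n → ℝ, ∑ i, f i = ∑ i ∈ P, f i + ∑ i ∈ Q, f i + ∑ i ∈ R, f i := by
    intro f
    rw [← Finset.sum_union hPQ, hR, Finset.sum_add_sum_compl]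
  have hn : (n : ℝ) = P.card + Q.card + R.card := by
    have := split fun _ => 1
    simpa using this
  have term : ∀ i, ∑ k, (if k ∈ A.part i then σ k else -σ k) = 2 * sum (A.part i) - sum .univ := by
    intro i
    have e : ∀ k, (if k ∈ A.part i then σ k else -σ k) =
        2 * (if k ∈ A.part i then σ k else 0) - σ k := by
      intro k; split_ifs <;> ring
    simp only [e, Finset.sum_sub_distrib, ← Finset.mul_sum, hsum]
    simp
  have huniv : sum .univ = sum P + sum Q + sum R := split σ
  have onP : ∀ i ∈ P, |∑ k, (if k ∈ A.part i then σ k else -σ k)| = |sum P - sum Q - sum R| := by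
    intro i hi
    rw [term, hP i hi, huniv]; congr 1; ring
  have onQ : ∀ i ∈ Q, |∑ k, (if k ∈ A.part i then σ k else -σ k)| = |sum Q - sum P - sum R| := by
    intro i hi
    rw [term, hQ i hi, huniv]; congr 1; ring
  -- For an unmatched index both `P` and `Q` lie on the same side of the split, and only indices of
  -- `R` can change the sum.
  have onR : ∀ i ∈ R, |sum P + sum Q| - R.card ≤
      |∑ k, (if k ∈ A.part i then σ k else -σ k)| := by
    intro i hi
    have hsub : A.part i ⊆ R := by
      intro k hk
      rw [hR, Finset.mem_compl, Finset.mem_union]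
      have hki : A.part k = A.part i :=
        (A.mem_part_iff_part_eq_part (Finset.mem_univ _) (Finset.mem_univ _)).1 hk
      have hii : i ∈ A.part i := by simp
      rw [hR, Finset.mem_compl, Finset.mem_union] at hi
      rintro (h | h)
      · rw [← hki, hP k h] at hii; exact hi (Or.inl hii)
      · rw [← hki, hQ k h] at hii; exact hi (Or.inr hii)
    have h1 := bound (A.part i)
    have h2 := bound (R \ A.part i)
    have h3 : sum (R \ A.part i) + sum (A.part i) = sum R := Finset.sum_sdiff hsub
    have h4 : ((R \ A.part i).card : ℝ) + (A.part i).card = R.card := by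
      exact_mod_cast Finset.card_sdiff_add_card_eq_card hsub
    rw [term, huniv]
    have h5 := abs_sub_abs_le_abs_sub (sum P + sum Q) (sum (A.part i) - sum (R \ A.part i))
    have h6 : |sum (A.part i) - sum (R \ A.part i)| ≤ R.card :=
      (abs_sub _ _).trans (by linarith)
    rw [show 2 * sum (A.part i) - (sum P + sum Q + sum R) =
      -((sum P + sum Q) - (sum (A.part i) - sum (R \ A.part i))) by rw [← h3]; ring, abs_neg]
    linarith
  rw [split, Finset.sum_congr rfl onP, Finset.sum_congr rfl onQ, Finset.sum_const,
    Finset.sum_const, nsmul_eq_mul, nsmul_eq_mul]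
  have hsumR := Finset.card_nsmul_le_sum R _ _ onR
  rw [nsmul_eq_mul] at hsumR
  have bP := abs_le.1 (bound P)
  have bQ := abs_le.1 (bound Q)
  have bR := abs_le.1 (bound R)
  have a1 : (P.card : ℝ) * (sum P - sum Q - sum R) ≤ P.card * |sum P - sum Q - sum R| :=
    mul_le_mul_of_nonneg_left (le_abs_self _) (by positivity)
  have a2 : (Q.card : ℝ) * (sum P - sum Q + sum R) ≤ Q.card * |sum Q - sum P - sum R| :=
    mul_le_mul_of_nonneg_left ((le_of_eq (by ring)).trans (neg_le_abs _)) (by positivity)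
  have a3 : (R.card : ℝ) * (sum P + sum Q) ≤ R.card * |sum P + sum Q| :=
    mul_le_mul_of_nonneg_left (le_abs_self _) (by positivity)
  have a4 : (R.card : ℝ) * -(sum P + sum Q) ≤ R.card * |sum P + sum Q| :=
    mul_le_mul_of_nonneg_left (neg_le_abs _) (by positivity)
  have r0 : (0 : ℝ) ≤ R.card := by positivity
  change (n : ℝ) * (sum P - sum Q - (n - P.card - Q.card)) ≤ _
  rw [hn]
  -- The term (|Q| - |P|) `sum R` costs at most |R| times the difference of the cardinalities. The
  -- slack left is 2|R|(|Q| + `sum Q`) in the first case and 2|R|(|P| - `sum P`) in the second.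
  rcases le_total (Q.card : ℝ) P.card with hc | hc
  · have a5 := mul_le_mul_of_nonneg_left bR.2 (sub_nonneg.2 hc)
    have a6 := mul_nonneg r0 (by linarith : 0 ≤ sum Q + Q.card)
    linarith
  · have a5 := mul_le_mul_of_nonneg_left bR.1 (sub_nonneg.2 hc)
    have a6 := mul_nonneg r0 (by linarith : 0 ≤ P.card - sum P)
    linarith

/-- The labels separating the block of `i` from the other blocks. -/
def blockLabel (A : Finpartition (Finset.univ : Finset (Fin n))) (i k : Fin n) : Fin 2 :=
  if k ∈ A.part i then 0 else 1

/-- At most two blocks of `A` are matched, one per level of `x`; they serve as P and Q in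
`pair_le_sum_abs`, and unmatched indices contribute nothing to the overlap. -/
lemma maxOverlap_labelPartition_le (hn : 1 ≤ n)
    (A : Finpartition (Finset.univ : Finset (Fin n))) (x : Fin n → Fin 2) :
    (maxOverlap A (labelPartition x) : ℝ) ≤
      (n + (1 / n) * ∑ i, |∑ k, labelSign (blockLabel A i k) * labelSign (x k)|) / 2 := by
  classical
  refine maxOverlap_le fun M hM => ?_
  set lev : Fin 2 → Finset (Fin n) := fun c => Finset.univ.filter fun i => x i = c with hlev
  -- The union has at most one term: `P c` is the block matched to level c, or empty if that level
  -- is unmatched.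
  set P : Fin 2 → Finset (Fin n) := fun c => (M.filter fun e => e.2 = lev c).biUnion Prod.fst
    with hPdef
  have memP : ∀ {c i}, i ∈ P c ↔ ∃ e ∈ M, e.2 = lev c ∧ i ∈ e.1 := by
    intro c i; simp [hPdef, and_assoc]
  have partM : ∀ {e i}, e ∈ M → i ∈ e.1 → A.part i = e.1 := fun he hi =>
    A.part_eq_of_mem (Finset.mem_product.1 (hM.1 he)).1 hi
  have uniq : ∀ {e e'}, e ∈ M → e' ∈ M → e.1 = e'.1 ∨ e.2 = e'.2 → e = e' := by
    intro e e' he he' h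
    by_contra hne
    have := hM.2 e he e' he' hne
    tauto
  have hP : ∀ c, ∀ i ∈ P c, A.part i = P c := by
    intro c i hi
    obtain ⟨e, he, hec, hie⟩ := memP.1 hi
    rw [partM he hie]
    ext j
    rw [memP]
    constructor
    · exact fun hj => ⟨e, he, hec, hj⟩
    · rintro ⟨e', he', hec', hj⟩
      rwa [uniq he he' (Or.inr (hec.trans hec'.symm))]
  have hdisj : Disjoint (P 0) (P 1) := by
    rw [Finset.disjoint_left]
    intro i h0 h1
    obtain ⟨e, he, hec, hie⟩ := memP.1 h0
    obtain ⟨e', he', hec', hie'⟩ := memP.1 h1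
    have := uniq he he' (Or.inl ((partM he hie).symm.trans (partM he' hie')))
    subst this
    have hne := (labelPartition x).nonempty_of_mem_parts (Finset.mem_product.1 (hM.1 he)).2
    obtain ⟨j, hj⟩ := hne
    have j0 : x j = 0 := by rw [hec] at hj; simpa [hlev] using hj
    have j1 : x j = 1 := by rw [hec'] at hj; simpa [hlev] using hj
    rw [j0] at j1; simp at j1
  have hcard : ∑ e ∈ M, (e.1 ∩ e.2).card ≤ (P 0 ∩ lev 0).card + (P 1 ∩ lev 1).card := by
    rw [sum_inter_card_matching hM]
    refine (Finset.card_le_card fun i hi => ?_).trans (Finset.card_union_le _ _)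
    obtain ⟨e, he, hie⟩ := Finset.mem_biUnion.1 hi
    rw [Finset.mem_inter] at hie
    obtain ⟨-, c, hc⟩ := mem_parts_labelPartition.1 (Finset.mem_product.1 (hM.1 he)).2
    have : i ∈ P c ∩ lev c :=
      Finset.mem_inter.2 ⟨memP.2 ⟨e, he, hc, hie.1⟩, by rw [hc] at hie; exact hie.2⟩
    rw [Finset.mem_union]
    revert this
    fin_cases c
    · exact Or.inl
    · exact Or.inr
  have e0 : ((P 0 ∩ lev 0).card : ℝ) = ((P 0).card + ∑ i ∈ P 0, labelSign (x i)) / 2 := by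
    rw [hlev, Finset.inter_filter, Finset.inter_univ, Finset.card_filter, Finset.card_eq_sum_ones]
    push_cast
    rw [← Finset.sum_add_distrib, Finset.sum_div]
    refine Finset.sum_congr rfl fun i _ => ?_
    generalize x i = a
    fin_cases a <;> norm_num
  have e1 : ((P 1 ∩ lev 1).card : ℝ) = ((P 1).card - ∑ i ∈ P 1, labelSign (x i)) / 2 := by
    rw [hlev, Finset.inter_filter, Finset.inter_univ, Finset.card_filter, Finset.card_eq_sum_ones]
    push_cast
    rw [← Finset.sum_sub_distrib, Finset.sum_div]
    refine Finset.sum_congr rfl fun i _ => ?_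
    generalize x i = a
    fin_cases a <;> norm_num
  have key := pair_le_sum_abs (fun i => labelSign (x i)) (fun i => by simp) A (P 0) (P 1) hdisj
    (hP 0) (hP 1)
  have hb : ∀ i k, labelSign (blockLabel A i k) * labelSign (x k) =
      if k ∈ A.part i then labelSign (x k) else -labelSign (x k) := by
    intro i k
    unfold blockLabel
    split_ifs <;> simp
  simp only [hb]
  have hn' : (0 : ℝ) < n := by exact_mod_cast hn
  rw [← le_div_iff₀' hn'] at key
  have hcard' : ((∑ e ∈ M, (e.1 ∩ e.2).card : ℕ) : ℝ) ≤
      (P 0 ∩ lev 0).card + (P 1 ∩ lev 1).card := by exact_mod_cast hcard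
  rw [one_div_mul_eq_div]
  linarith

end overlap

/-! ### The posterior law of the labels -/

/-- A product of measures with bounded real densities has the product density. -/
lemma pi_withDensity_ofReal {n : ℕ} {𝕐 : Type*} [MeasurableSpace 𝕐] (μ : Measure 𝕐)
    [IsProbabilityMeasure μ] (ρ : Fin n → 𝕐 → ℝ) (hm : ∀ i, Measurable (ρ i))
    (h0 : ∀ i y, 0 ≤ ρ i y) (h1 : ∀ i y, ρ i y ≤ 1) :
    Measure.pi (fun i => μ.withDensity fun y => ENNReal.ofReal (ρ i y)) =
      (Measure.pi fun _ : Fin n => μ).withDensity fun y => ENNReal.ofReal (∏ i, ρ i (y i)) := by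
  have hint : ∀ i, Integrable (ρ i) μ := fun i =>
    Integrable.of_bound (hm i).aestronglyMeasurable 1
      (.of_forall fun y => by rw [Real.norm_of_nonneg (h0 i y)]; exact h1 i y)
  have (i : Fin n) : IsFiniteMeasure (μ.withDensity fun y => ENNReal.ofReal (ρ i y)) :=
    isFiniteMeasure_withDensity_ofReal (hint i).2
  refine Measure.pi_eq fun s hs => ?_
  rw [withDensity_apply _ (MeasurableSet.univ_pi hs), Measure.restrict_pi_pi,
    ← ofReal_integral_eq_lintegral_ofReal, integral_fintype_prod_eq_prod,
    ENNReal.ofReal_prod_of_nonneg]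
  · refine Finset.prod_congr rfl fun i _ => ?_
    rw [withDensity_apply _ (hs i), ← ofReal_integral_eq_lintegral_ofReal (hint i).integrableOn
      (.of_forall (h0 i))]
  · exact fun i _ => integral_nonneg (h0 i)
  · exact Integrable.fintype_prod_dep fun i => (hint i).integrableOn
  · exact .of_forall fun y => Finset.prod_nonneg fun i _ => h0 i _

namespace HMMParam

variable {𝕐 : Type*} [MeasurableSpace 𝕐] {L : Measure 𝕐} (θ : HMMParam 2 𝕐 L)

/-- The joint density of one label and one observation. -/
def jointDensity (c : Fin 2) (y : 𝕐) : ℝ := (θ.ν c).toReal * θ.f c y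

/-- The posterior mean of the sign of the label, given the observation `y`. -/
def contrast (y : 𝕐) : ℝ :=
  (θ.jointDensity 0 y - θ.jointDensity 1 y) / (θ.jointDensity 0 y + θ.jointDensity 1 y)

/-- The law of one observation. -/
def marginal : Measure 𝕐 :=
  L.withDensity fun y => ENNReal.ofReal (θ.jointDensity 0 y + θ.jointDensity 1 y)

lemma jointDensity_nonneg (c : Fin 2) (y : 𝕐) : 0 ≤ θ.jointDensity c y := by
  unfold jointDensity; positivity

lemma measurable_jointDensity (c : Fin 2) : Measurable (θ.jointDensity c) :=
  ((θ.measurable_f c).coe_nnreal_real).const_mul _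

lemma measurable_contrast : Measurable θ.contrast :=
  ((θ.measurable_jointDensity 0).sub (θ.measurable_jointDensity 1)).div
    ((θ.measurable_jointDensity 0).add (θ.measurable_jointDensity 1))

lemma abs_contrast_le (y : 𝕐) : |θ.contrast y| ≤ 1 := by
  have h0 := θ.jointDensity_nonneg 0 y
  have h1 := θ.jointDensity_nonneg 1 y
  unfold contrast
  rw [abs_div, abs_of_nonneg (add_nonneg h0 h1)]
  refine div_le_one_of_le₀ (abs_le.2 ⟨?_, ?_⟩) (add_nonneg h0 h1) <;> linarith

lemma add_mul_signWeight_contrast (c : Fin 2) (y : 𝕐) :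
    (θ.jointDensity 0 y + θ.jointDensity 1 y) * signWeight (θ.contrast y) c =
      θ.jointDensity c y := by
  have h0 := θ.jointDensity_nonneg 0 y
  have h1 := θ.jointDensity_nonneg 1 y
  rcases (add_nonneg h0 h1).eq_or_lt with h | h
  -- Where both densities vanish the contrast is 0/0 = 0, and both sides are 0.
  · have e0 : θ.jointDensity 0 y = 0 := by linarith
    have e1 : θ.jointDensity 1 y = 0 := by linarith
    fin_cases c <;> simp [e0, e1]
  · unfold contrast signWeight
    fin_cases c <;> simp <;> field_simp <;> ring

lemma ofReal_jointDensity (c : Fin 2) (y : 𝕐) :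
    ENNReal.ofReal (θ.jointDensity c y) = θ.ν c * (θ.f c y : ℝ≥0∞) := by
  rw [jointDensity, ENNReal.ofReal_mul ENNReal.toReal_nonneg,
    ENNReal.ofReal_toReal ((θ.ν).apply_ne_top c), ENNReal.ofReal_coe_nnreal]

lemma withDensity_jointDensity (c : Fin 2) :
    L.withDensity (fun y => ENNReal.ofReal (θ.jointDensity c y)) = θ.ν c • θ.emission c := by
  rw [emission, ← withDensity_smul _ (θ.measurable_f c).coe_nnreal_ennreal]
  congr 1; ext y
  simp [ofReal_jointDensity]

lemma marginal_eq : θ.marginal = θ.ν 0 • θ.emission 0 + θ.ν 1 • θ.emission 1 := by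
  rw [← withDensity_jointDensity, ← withDensity_jointDensity,
    ← withDensity_add_left (θ.measurable_jointDensity 0).ennreal_ofReal, marginal]
  congr 1; ext y
  exact ENNReal.ofReal_add (θ.jointDensity_nonneg 0 y) (θ.jointDensity_nonneg 1 y)

instance : IsProbabilityMeasure θ.marginal := by
  refine ⟨?_⟩
  have := θ.ν.tsum_coe
  rw [tsum_fintype, Fin.sum_univ_two] at this
  simp [marginal_eq, this]

/-- Bayes' formula: relative to the law of one observation, the joint law has the posterior
probability as density. Unlike `f`, this density is bounded by 1, and the reference is a probability
measure. -/
lemma smul_emission (c : Fin 2) : θ.ν c • θ.emission c =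
    θ.marginal.withDensity fun y => ENNReal.ofReal (signWeight (θ.contrast y) c) := by
  have hm : Measurable fun y => signWeight (θ.contrast y) c := by
    have := θ.measurable_contrast
    unfold signWeight; fun_prop
  rw [← withDensity_jointDensity, marginal, ← withDensity_mul]
  · congr 1; ext y
    rw [Pi.mul_apply, ← ENNReal.ofReal_mul
      (add_nonneg (θ.jointDensity_nonneg 0 y) (θ.jointDensity_nonneg 1 y)),
      add_mul_signWeight_contrast]
  · exact ((θ.measurable_jointDensity 0).add (θ.measurable_jointDensity 1)).ennreal_ofReal
  · exact hm.ennreal_ofReal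

lemma measurable_signWeight_contrast (c : Fin 2) :
    Measurable fun y => signWeight (θ.contrast y) c := by
  have := θ.measurable_contrast
  unfold signWeight; fun_prop

lemma pathProb_smul_pi (hθ : θ.IsIndependent) {n : ℕ} (x : Fin n → Fin 2) :
    θ.pathProb x • Measure.pi (fun i => θ.emission (x i)) =
      (Measure.pi fun _ : Fin n => θ.marginal).withDensity
        fun y => ENNReal.ofReal (∏ i, signWeight (θ.contrast (y i)) (x i)) := by
  rw [← pi_withDensity_ofReal θ.marginal (fun i y => signWeight (θ.contrast y) (x i))
    (fun i => θ.measurable_signWeight_contrast _)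
    (fun i y => signWeight_nonneg (θ.abs_contrast_le y) _)
    (fun i y => signWeight_le_one (θ.abs_contrast_le y) _)]
  simp only [← smul_emission]
  have (i : Fin n) : IsFiniteMeasure (θ.ν (x i) • θ.emission (x i)) :=
    Measure.smul_finite _ (θ.ν.apply_ne_top _)
  symm
  refine Measure.pi_eq fun s hs => ?_
  have hp : θ.pathProb x = ∏ i, θ.ν (x i) := by
    unfold pathProb
    exact Finset.prod_congr rfl fun i _ => by rw [hθ, ite_self]
  simp [hp, Measure.pi_pi, Finset.prod_mul_distrib]

/-- Conditioning on the observations: every risk becomes an integral over i.i.d. observations of a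
finite expectation over independent labels. -/
lemma integral_law (hθ : θ.IsIndependent) {n : ℕ}
    (F : (Fin n → Fin 2) → (Fin n → 𝕐) → ℝ) (hF : ∀ x, Measurable (F x)) (b : ℝ)
    (hb : ∀ x y, |F x y| ≤ b) :
    ∫ z, F z.1 z.2 ∂(θ.law n) =
      ∫ y, prodExp (fun i => signWeight (θ.contrast (y i))) (fun x => F x y)
        ∂(Measure.pi fun _ : Fin n => θ.marginal) := by
  have hFm : Measurable fun z : (Fin n → Fin 2) × (Fin n → 𝕐) => F z.1 z.2 :=
    measurable_from_prod_countable_right hF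
  have hw0 : ∀ (x : Fin n → Fin 2) (y : Fin n → 𝕐),
      0 ≤ ∏ i, signWeight (θ.contrast (y i)) (x i) := fun x y =>
    Finset.prod_nonneg fun i _ => signWeight_nonneg (θ.abs_contrast_le _) _
  have hw1 : ∀ (x : Fin n → Fin 2) (y : Fin n → 𝕐),
      ∏ i, signWeight (θ.contrast (y i)) (x i) ≤ 1 := fun x y =>
    Finset.prod_le_one (fun i _ => signWeight_nonneg (θ.abs_contrast_le _) _)
      fun i _ => signWeight_le_one (θ.abs_contrast_le _) _
  have hwm : ∀ x : Fin n → Fin 2, Measurable fun y : Fin n → 𝕐 =>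
      ∏ i, signWeight (θ.contrast (y i)) (x i) := fun x =>
    Finset.measurable_fun_prod _ fun i _ =>
      (θ.measurable_signWeight_contrast (x i)).comp (measurable_pi_apply i)
  have hlaw : ∀ x : Fin n → Fin 2,
      θ.pathProb x • (Measure.dirac x).prod (Measure.pi fun i => θ.emission (x i)) =
        ((Measure.pi fun _ : Fin n => θ.marginal).withDensity
          fun y => ENNReal.ofReal (∏ i, signWeight (θ.contrast (y i)) (x i))).map
            (Prod.mk x) := by
    intro x
    rw [Measure.dirac_prod, ← Measure.map_smul, θ.pathProb_smul_pi hθ]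
  have hfin : ∀ x : Fin n → Fin 2, IsFiniteMeasure
      ((Measure.pi fun _ : Fin n => θ.marginal).withDensity
          fun y => ENNReal.ofReal (∏ i, signWeight (θ.contrast (y i)) (x i))) := by
    intro x
    refine isFiniteMeasure_withDensity_ofReal (Integrable.of_bound
      (hwm x).aestronglyMeasurable 1 (.of_forall fun y => ?_)).2
    rw [Real.norm_of_nonneg (hw0 x y)]; exact hw1 x y
  unfold law
  simp only [hlaw]
  rw [integral_finsetSum_measure]
  · unfold prodExp
    rw [integral_finsetSum]
    · refine Finset.sum_congr rfl fun x _ => ?_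
      rw [integral_map measurable_prodMk_left.aemeasurable hFm.aestronglyMeasurable,
        integral_withDensity_eq_integral_toReal_smul (hwm x).ennreal_ofReal
          (.of_forall fun y => ENNReal.ofReal_lt_top)]
      refine integral_congr_ae (.of_forall fun y => ?_)
      simp only [ENNReal.toReal_ofReal (hw0 x y), smul_eq_mul]
    · intro x _
      refine Integrable.of_bound ((hwm x).mul (hF x)).aestronglyMeasurable b
        (.of_forall fun y => ?_)
      rw [norm_mul, Real.norm_of_nonneg (hw0 x y), Real.norm_eq_abs]
      have := mul_le_mul (hw1 x y) (hb x y) (abs_nonneg _) zero_le_one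
      linarith
  · intro x _
    have := hfin x
    exact Integrable.of_bound hFm.aestronglyMeasurable b (.of_forall fun z => hb _ _)

/-- The mean absolute posterior contrast. -/
def meanContrast : ℝ := ∫ y, |θ.contrast y| ∂θ.marginal

lemma integrable_abs_contrast : Integrable (fun y => |θ.contrast y|) θ.marginal :=
  Integrable.of_bound θ.measurable_contrast.abs.aestronglyMeasurable 1
    (.of_forall fun y => by rw [Real.norm_eq_abs, abs_abs]; exact θ.abs_contrast_le y)

lemma meanContrast_nonneg : 0 ≤ θ.meanContrast := integral_nonneg fun _ => abs_nonneg _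

lemma meanContrast_le_one : θ.meanContrast ≤ 1 := by
  have := integral_mono θ.integrable_abs_contrast (integrable_const 1) θ.abs_contrast_le
  simpa [meanContrast] using this

lemma integrable_signWeight_abs (c : Fin 2) :
    Integrable (fun y => signWeight |θ.contrast y| c) θ.marginal := by
  unfold signWeight
  exact (((integrable_const 1).add (θ.integrable_abs_contrast.mul_const _)).div_const 2)

lemma integral_signWeight_abs (c : Fin 2) :
    ∫ y, signWeight |θ.contrast y| c ∂θ.marginal = signWeight θ.meanContrast c := by
  unfold signWeight
  rw [integral_div, integral_add (integrable_const 1) (θ.integrable_abs_contrast.mul_const _),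
    integral_mul_const]
  simp [meanContrast]

lemma integrable_prodExp_abs {n : ℕ} (F : (Fin n → Fin 2) → ℝ) :
    Integrable (fun y => prodExp (fun i => signWeight |θ.contrast (y i)|) F)
      (Measure.pi fun _ : Fin n => θ.marginal) :=
  integrable_finsetSum _ fun x _ => (Integrable.fintype_prod_dep
    (f := fun i y => signWeight |θ.contrast y| (x i))
    fun i => θ.integrable_signWeight_abs (x i)).mul_const _

/-- The product weight is affine in each |contrast| separately and the observations are independent,
so each factor may be replaced by its mean. -/
lemma integral_prodExp_abs {n : ℕ} (F : (Fin n → Fin 2) → ℝ) :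
    ∫ y, prodExp (fun i => signWeight |θ.contrast (y i)|) F
        ∂(Measure.pi fun _ : Fin n => θ.marginal) =
      prodExp (fun _ => signWeight θ.meanContrast) F := by
  unfold prodExp
  rw [integral_finsetSum]
  · refine Finset.sum_congr rfl fun x _ => ?_
    rw [integral_mul_const, integral_fintype_prod_eq_prod
      (fun i y => signWeight |θ.contrast y| (x i))]
    simp only [integral_signWeight_abs]
  · exact fun x _ => (Integrable.fintype_prod_dep
      (f := fun i y => signWeight |θ.contrast y| (x i))
      fun i => θ.integrable_signWeight_abs (x i)).mul_const _

lemma integrable_sum_abs_contrast {n : ℕ} :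
    Integrable (fun y : Fin n → 𝕐 => ∑ i, |θ.contrast (y i)|)
      (Measure.pi fun _ : Fin n => θ.marginal) := by
  have := θ.integrable_prodExp_abs (n := n) fun x => ∑ i, labelSign (x i)
  simpa only [prodExp_sum, prodExp_labelSign] using this

lemma integral_sum_abs_contrast {n : ℕ} :
    ∫ y : Fin n → 𝕐, ∑ i, |θ.contrast (y i)| ∂(Measure.pi fun _ : Fin n => θ.marginal) =
      n * θ.meanContrast := by
  have := θ.integral_prodExp_abs (n := n) fun x => ∑ i, labelSign (x i)
  simp only [prodExp_sum, prodExp_labelSign] at this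
  simpa using this

end HMMParam

/-! ### The Bayes risks as expectations of a biased random walk -/

/-- The expectation of `φ` at the sum of `n` independent signs of mean `δ`. -/
def walkExp (n : ℕ) (δ : ℝ) (φ : ℝ → ℝ) : ℝ :=
  prodExp (fun _ : Fin n => signWeight δ) fun x => φ (∑ i, labelSign (x i))

lemma prodExp_classLoss {n : ℕ} (hn : 1 ≤ n) (m : Fin n → ℝ) (h : Fin n → Fin 2) :
    prodExp (fun i => signWeight (m i))
      (fun x => (1 / (n : ℝ)) * ∑ i, (if h i ≠ x i then (1 : ℝ) else 0)) =
      (1 - (1 / (n : ℝ)) * ∑ i, labelSign (h i) * m i) / 2 := by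
  have key : ∀ x : Fin n → Fin 2, ∀ i, (if h i ≠ x i then (1 : ℝ) else 0) =
      1 / 2 - labelSign (h i) / 2 * labelSign (x i) := by
    intro x i
    generalize h i = a
    generalize x i = b
    fin_cases a <;> fin_cases b <;> norm_num
  have hn' : (n : ℝ) ≠ 0 := by positivity
  simp only [key]
  rw [prodExp_const_mul, prodExp_sum]
  have : ∀ i, prodExp (fun i => signWeight (m i))
      (fun x => 1 / 2 - labelSign (h i) / 2 * labelSign (x i)) =
      1 / 2 - labelSign (h i) * m i / 2 := by
    intro i
    rw [prodExp_sub, prodExp_const (fun i => sum_signWeight _), prodExp_const_mul,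
      prodExp_labelSign]
    ring
  simp only [this, Finset.sum_sub_distrib, ← Finset.sum_div]
  simp
  field_simp

lemma classLoss_mem {n : ℕ} (h x : Fin n → Fin 2) :
    |(1 / (n : ℝ)) * ∑ i, (if h i ≠ x i then (1 : ℝ) else 0)| ≤ 1 := by
  have h0 : 0 ≤ ∑ i, (if h i ≠ x i then (1 : ℝ) else 0) :=
    Finset.sum_nonneg fun i _ => by split_ifs <;> norm_num
  have h1 : ∑ i, (if h i ≠ x i then (1 : ℝ) else 0) ≤ n := by
    refine (Finset.sum_le_card_nsmul _ _ 1 fun i _ => by split_ifs <;> norm_num).trans ?_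
    simp
  rw [abs_of_nonneg (by positivity), one_div_mul_eq_div]
  exact div_le_one_of_le₀ h1 (by positivity)

lemma clusterLoss_labelPartition_ge {n : ℕ} (hn : 1 ≤ n)
    (A : Finpartition (Finset.univ : Finset (Fin n))) (x : Fin n → Fin 2) :
    1 / 2 - 1 / (2 * (n : ℝ)) *
      ((1 / (n : ℝ)) * ∑ i, |∑ k, labelSign (blockLabel A i k) * labelSign (x k)|) ≤
      clusterLoss A (labelPartition x) := by
  have hn' : (0 : ℝ) < n := by exact_mod_cast hn
  have := mul_le_mul_of_nonneg_left (maxOverlap_labelPartition_le hn A x)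
    (by positivity : 0 ≤ 1 / (n : ℝ))
  unfold clusterLoss
  refine le_trans (le_of_eq ?_) (sub_le_sub_left this 1)
  field_simp
  ring

lemma clusterLoss_labelPartition_le {n : ℕ} (hn : 1 ≤ n) (h x : Fin n → Fin 2) :
    clusterLoss (labelPartition h) (labelPartition x) ≤
      1 / 2 - 1 / (2 * (n : ℝ)) * |∑ k, labelSign (h k) * labelSign (x k)| := by
  have hn' : (0 : ℝ) < n := by exact_mod_cast hn
  have := mul_le_mul_of_nonneg_left (le_maxOverlap_labelPartition h x)
    (by positivity : 0 ≤ 1 / (n : ℝ))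
  unfold clusterLoss
  refine (sub_le_sub_left this 1).trans (le_of_eq ?_)
  field_simp
  ring

lemma maxOverlap_le_card {n : ℕ} (A B : Finpartition (Finset.univ : Finset (Fin n))) :
    (maxOverlap A B : ℝ) ≤ n := by
  refine maxOverlap_le fun M hM => ?_
  rw [sum_inter_card_matching hM]
  exact_mod_cast (Finset.card_le_univ _).trans (by simp)

lemma abs_clusterLoss_le {n : ℕ} (A B : Finpartition (Finset.univ : Finset (Fin n))) :
    |clusterLoss A B| ≤ 1 := by
  have h1 : (1 / (n : ℝ)) * maxOverlap A B ≤ 1 := by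
    rw [one_div_mul_eq_div]
    exact div_le_one_of_le₀ (maxOverlap_le_card A B) (by positivity)
  have h0 : 0 ≤ (1 / (n : ℝ)) * maxOverlap A B := by positivity
  unfold clusterLoss
  rw [abs_le]; constructor <;> linarith

/-- Each split in the averaged overlap bound is a labelling, and none beats the labelling by the
signs of the means. `prodExp_clusterLoss_signLabel_le` shows that this bound is attained. -/
lemma prodExp_clusterLoss_ge {n : ℕ} (hn : 1 ≤ n) (m : Fin n → ℝ) (hm : ∀ i, |m i| ≤ 1)
    (A : Finpartition (Finset.univ : Finset (Fin n))) :
    1 / 2 - 1 / (2 * (n : ℝ)) * prodExp (fun i => signWeight |m i|)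
        (fun x => |∑ i, labelSign (x i)|) ≤
      prodExp (fun i => signWeight (m i)) (fun x => clusterLoss A (labelPartition x)) := by
  have hn' : (0 : ℝ) < n := by exact_mod_cast hn
  refine le_trans ?_ (prodExp_mono (fun i c => signWeight_nonneg (hm i) c)
    (clusterLoss_labelPartition_ge hn A))
  rw [prodExp_sub, prodExp_const (fun i => sum_signWeight _), prodExp_const_mul,
    prodExp_const_mul, prodExp_sum]
  refine sub_le_sub_left (mul_le_mul_of_nonneg_left ?_ (by positivity)) _
  rw [one_div_mul_eq_div, div_le_iff₀ hn']
  refine (Finset.sum_le_card_nsmul _ _ _ fun i _ => prodExp_abs_le m hm _).trans (le_of_eq ?_)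
  simp [mul_comm]

lemma prodExp_clusterLoss_signLabel_le {n : ℕ} (hn : 1 ≤ n) (m : Fin n → ℝ)
    (hm : ∀ i, |m i| ≤ 1) :
    prodExp (fun i => signWeight (m i))
        (fun x => clusterLoss (labelPartition fun i => signLabel (m i)) (labelPartition x)) ≤
      1 / 2 - 1 / (2 * (n : ℝ)) * prodExp (fun i => signWeight |m i|)
        (fun x => |∑ i, labelSign (x i)|) := by
  refine (prodExp_mono (fun i c => signWeight_nonneg (hm i) c)
    (clusterLoss_labelPartition_le hn _)).trans (le_of_eq ?_)
  rw [prodExp_sub, prodExp_const (fun i => sum_signWeight _), prodExp_const_mul,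
    prodExp_abs_signLabel]

namespace HMMParam

variable {𝕐 : Type*} [MeasurableSpace 𝕐] {L : Measure 𝕐} (θ : HMMParam 2 𝕐 L)

/-- The Bayes classifier: the sign of the posterior contrast of each observation. -/
def bayesClassifier (n : ℕ) : Classifier n 2 𝕐 :=
  ⟨fun y i => signLabel (θ.contrast (y i)), measurable_pi_lambda _ fun i =>
    (Measurable.ite measurableSet_Ici measurable_const measurable_const).comp
      (θ.measurable_contrast.comp (measurable_pi_apply i))⟩

/-- The clusterer given by the level sets of the Bayes classifier. -/
def bayesClusterer (n : ℕ) : Clusterer n 𝕐 :=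
  ⟨fun y => labelPartition ((θ.bayesClassifier n).1 y), fun A =>
    (θ.bayesClassifier n).2 (Set.toFinite (labelPartition ⁻¹' {A})).measurableSet⟩

lemma measurable_prodExp {n : ℕ} (F : (Fin n → Fin 2) → (Fin n → 𝕐) → ℝ)
    (hF : ∀ x, Measurable (F x)) :
    Measurable fun y : Fin n → 𝕐 =>
      prodExp (fun i => signWeight (θ.contrast (y i))) (fun x => F x y) :=
  Finset.measurable_fun_sum _ fun x _ => (Finset.measurable_fun_prod _ fun i _ =>
    (θ.measurable_signWeight_contrast (x i)).comp (measurable_pi_apply i)).mul (hF x)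

lemma integrable_prodExp {n : ℕ} (F : (Fin n → Fin 2) → (Fin n → 𝕐) → ℝ)
    (hF : ∀ x, Measurable (F x)) (b : ℝ) (hb : ∀ x y, |F x y| ≤ b) :
    Integrable (fun y : Fin n → 𝕐 =>
      prodExp (fun i => signWeight (θ.contrast (y i))) (fun x => F x y))
      (Measure.pi fun _ : Fin n => θ.marginal) := by
  refine Integrable.of_bound (θ.measurable_prodExp F hF).aestronglyMeasurable b
    (.of_forall fun y => ?_)
  have hw : ∀ (i : Fin n) c, 0 ≤ signWeight (θ.contrast (y i)) c := fun i c =>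
    signWeight_nonneg (θ.abs_contrast_le _) c
  rw [Real.norm_eq_abs, abs_le]
  constructor
  · rw [← prodExp_const (w := fun i => signWeight (θ.contrast (y i)))
      (fun i => sum_signWeight _) (-b)]
    exact prodExp_mono hw fun x => (abs_le.1 (hb x y)).1
  · rw [← prodExp_const (w := fun i => signWeight (θ.contrast (y i)))
      (fun i => sum_signWeight _) b]
    exact prodExp_mono hw fun x => (abs_le.1 (hb x y)).2

lemma measurable_classLoss {n : ℕ} (h : Classifier n 2 𝕐) (x : Fin n → Fin 2) :
    Measurable fun y => (1 / (n : ℝ)) * ∑ i, (if h.1 y i ≠ x i then (1 : ℝ) else 0) :=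
  (measurable_of_finite fun k : Fin n → Fin 2 =>
    (1 / (n : ℝ)) * ∑ i, (if k i ≠ x i then (1 : ℝ) else 0)).comp h.2

lemma measurable_clusterLoss {n : ℕ} (g : Clusterer n 𝕐) (x : Fin n → Fin 2) :
    Measurable fun y => clusterLoss (g.1 y) (labelPartition x) := by
  let : MeasurableSpace (Finpartition (Finset.univ : Finset (Fin n))) := ⊤
  have hg : Measurable g.1 := measurable_to_countable' g.2
  exact (measurable_from_top (f := fun A => clusterLoss A (labelPartition x))).comp hg

variable {θ}

lemma classRisk_eq (hθ : θ.IsIndependent) {n : ℕ} (hn : 1 ≤ n) (h : Classifier n 2 𝕐) :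
    θ.classRisk n h = ∫ y : Fin n → 𝕐,
      (1 - (1 / (n : ℝ)) * ∑ i, labelSign (h.1 y i) * θ.contrast (y i)) / 2
        ∂(Measure.pi fun _ : Fin n => θ.marginal) := by
  unfold classRisk
  rw [θ.integral_law hθ
    (fun x y => (1 / (n : ℝ)) * ∑ i, (if h.1 y i ≠ x i then (1 : ℝ) else 0))
    (measurable_classLoss h) 1 (fun x y => classLoss_mem _ _)]
  simp only [prodExp_classLoss hn]

lemma integral_bayesClassRisk {n : ℕ} (hn : 1 ≤ n) :
    ∫ y : Fin n → 𝕐, (1 - (1 / (n : ℝ)) * ∑ i, |θ.contrast (y i)|) / 2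
        ∂(Measure.pi fun _ : Fin n => θ.marginal) = (1 - θ.meanContrast) / 2 := by
  have hn' : (n : ℝ) ≠ 0 := by positivity
  rw [integral_div, integral_sub (integrable_const 1) (θ.integrable_sum_abs_contrast.const_mul _),
    integral_const_mul, integral_sum_abs_contrast]
  simp
  field_simp

lemma bayesClassRisk_eq (hθ : θ.IsIndependent) {n : ℕ} (hn : 1 ≤ n) :
    θ.bayesClassRisk n = (1 - θ.meanContrast) / 2 := by
  have : Nonempty (Classifier n 2 𝕐) := ⟨θ.bayesClassifier n⟩
  have hle : ∀ h : Classifier n 2 𝕐, (1 - θ.meanContrast) / 2 ≤ θ.classRisk n h := by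
    intro h
    rw [← integral_bayesClassRisk (θ := θ) hn, classRisk_eq hθ hn]
    refine integral_mono (((integrable_const 1).sub
      (θ.integrable_sum_abs_contrast.const_mul _)).div_const 2) ?_ fun y => ?_
    · simp only [← prodExp_classLoss hn]
      exact θ.integrable_prodExp
        (fun x y => (1 / (n : ℝ)) * ∑ i, (if h.1 y i ≠ x i then (1 : ℝ) else 0))
        (measurable_classLoss h) 1 fun x y => classLoss_mem _ _
    · refine div_le_div_of_nonneg_right (sub_le_sub_left (mul_le_mul_of_nonneg_left
        (Finset.sum_le_sum fun i _ => ?_) (by positivity)) _) (by norm_num)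
      refine (le_abs_self _).trans ?_
      rw [abs_mul, abs_labelSign, one_mul]
  refine le_antisymm ?_ (le_ciInf hle)
  refine (ciInf_le ⟨_, Set.forall_mem_range.2 hle⟩ (θ.bayesClassifier n)).trans (le_of_eq ?_)
  rw [classRisk_eq hθ hn, ← integral_bayesClassRisk (θ := θ) hn]
  simp only [bayesClassifier, labelSign_signLabel_mul]

lemma integral_bayesClustRisk {n : ℕ} :
    ∫ y : Fin n → 𝕐, (1 / 2 - 1 / (2 * (n : ℝ)) * prodExp
        (fun i => signWeight |θ.contrast (y i)|) fun x => |∑ i, labelSign (x i)|)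
        ∂(Measure.pi fun _ : Fin n => θ.marginal) =
      1 / 2 - 1 / (2 * (n : ℝ)) * walkExp n θ.meanContrast (fun t => |t|) := by
  rw [integral_sub (integrable_const _) ((θ.integrable_prodExp_abs _).const_mul _),
    integral_const_mul, integral_prodExp_abs, walkExp]
  simp

/-- The pointwise conditional bound is attained by the level sets of the Bayes classifier, so it can
be integrated without loss. -/
lemma bayesClustRisk_eq (hθ : θ.IsIndependent) {n : ℕ} (hn : 1 ≤ n) :
    θ.bayesClustRisk n =
      1 / 2 - 1 / (2 * (n : ℝ)) * walkExp n θ.meanContrast (fun t => |t|) := by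
  have : Nonempty (Clusterer n 𝕐) := ⟨θ.bayesClusterer n⟩
  have hint := (integrable_const (μ := Measure.pi fun _ : Fin n => θ.marginal) (1 / 2 : ℝ)).sub
    ((θ.integrable_prodExp_abs fun x : Fin n → Fin 2 => |∑ i, labelSign (x i)|).const_mul
      (1 / (2 * (n : ℝ))))
  have hrisk : ∀ g : Clusterer n 𝕐, θ.clustRisk n g =
      ∫ y, prodExp (fun i => signWeight (θ.contrast (y i)))
        (fun x => clusterLoss (g.1 y) (labelPartition x))
        ∂(Measure.pi fun _ : Fin n => θ.marginal) := fun g =>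
    θ.integral_law hθ (fun x y => clusterLoss (g.1 y) (labelPartition x))
      (measurable_clusterLoss g) 1 fun x y => abs_clusterLoss_le _ _
  have hint' : ∀ g : Clusterer n 𝕐, Integrable (fun y : Fin n → 𝕐 =>
      prodExp (fun i => signWeight (θ.contrast (y i)))
        (fun x => clusterLoss (g.1 y) (labelPartition x)))
        (Measure.pi fun _ : Fin n => θ.marginal) := fun g =>
    θ.integrable_prodExp (fun x y => clusterLoss (g.1 y) (labelPartition x))
      (measurable_clusterLoss g) 1 fun x y => abs_clusterLoss_le _ _
  rw [← integral_bayesClustRisk]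
  have hle : ∀ g : Clusterer n 𝕐, ∫ y : Fin n → 𝕐, (1 / 2 - 1 / (2 * (n : ℝ)) * prodExp
        (fun i => signWeight |θ.contrast (y i)|) fun x => |∑ i, labelSign (x i)|)
        ∂(Measure.pi fun _ : Fin n => θ.marginal) ≤ θ.clustRisk n g := by
    intro g
    rw [hrisk]
    exact integral_mono hint (hint' g) fun y =>
      prodExp_clusterLoss_ge hn _ (fun i => θ.abs_contrast_le _) _
  refine le_antisymm ?_ (le_ciInf hle)
  refine (ciInf_le ⟨_, Set.forall_mem_range.2 hle⟩ (θ.bayesClusterer n)).trans ?_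
  rw [hrisk]
  exact integral_mono (hint' _) hint fun y =>
    prodExp_clusterLoss_signLabel_le hn _ fun i => θ.abs_contrast_le _

end HMMParam

end

/-! ### Estimates for the biased random walk -/

section walk

variable {n : ℕ} {δ : ℝ}

lemma walkExp_zero (φ : ℝ → ℝ) : walkExp 0 δ φ = φ 0 := by
  simp [walkExp, prodExp_zero]

lemma walkExp_succ (φ : ℝ → ℝ) : walkExp (n + 1) δ φ =
    (1 + δ) / 2 * walkExp n δ (fun t => φ (t + 1)) +
      (1 - δ) / 2 * walkExp n δ (fun t => φ (t - 1)) := by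
  unfold walkExp
  rw [prodExp_succ]
  simp only [Fin.sum_univ_succ, Fin.cons_zero, Fin.cons_succ, labelSign_zero, labelSign_one,
    add_comm (1 : ℝ), neg_add_eq_sub, signWeight, mul_one, mul_neg]

lemma walkExp_add (φ ψ : ℝ → ℝ) :
    walkExp n δ (fun t => φ t + ψ t) = walkExp n δ φ + walkExp n δ ψ := prodExp_add _ _ _

lemma walkExp_sub (φ ψ : ℝ → ℝ) :
    walkExp n δ (fun t => φ t - ψ t) = walkExp n δ φ - walkExp n δ ψ := prodExp_sub _ _ _

lemma walkExp_const_mul (a : ℝ) (φ : ℝ → ℝ) :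
    walkExp n δ (fun t => a * φ t) = a * walkExp n δ φ := prodExp_const_mul _ _ _

lemma walkExp_const (a : ℝ) : walkExp n δ (fun _ => a) = a :=
  prodExp_const (fun _ => sum_signWeight _) a

lemma walkExp_mono (hδ : |δ| ≤ 1) {φ ψ : ℝ → ℝ} (h : ∀ t, φ t ≤ ψ t) :
    walkExp n δ φ ≤ walkExp n δ ψ :=
  prodExp_mono (fun _ c => signWeight_nonneg hδ c) fun _ => h _

lemma walkExp_id : walkExp n δ (fun t => t) = n * δ := by
  unfold walkExp
  rw [prodExp_sum]
  simp [prodExp_labelSign]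

lemma walkExp_sq : walkExp n δ (fun t => t ^ 2) = n * (1 - δ ^ 2) + (n * δ) ^ 2 := by
  induction n with
  | zero => simp [walkExp_zero]
  | succ n ih =>
    rw [walkExp_succ]
    have e1 : walkExp n δ (fun t => (t + 1) ^ 2) =
        walkExp n δ (fun t => t ^ 2) + 2 * walkExp n δ (fun t => t) + 1 := by
      rw [← walkExp_const_mul, ← walkExp_add]
      nth_rewrite 2 [← walkExp_const (n := n) (δ := δ) 1]
      rw [← walkExp_add]
      congr 1; ext t; ring
    have e2 : walkExp n δ (fun t => (t - 1) ^ 2) =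
        walkExp n δ (fun t => t ^ 2) - 2 * walkExp n δ (fun t => t) + 1 := by
      rw [← walkExp_const_mul, ← walkExp_sub]
      nth_rewrite 2 [← walkExp_const (n := n) (δ := δ) 1]
      rw [← walkExp_add]
      congr 1; ext t; ring
    rw [e1, e2, ih, walkExp_id]
    push_cast
    ring

lemma walkExp_zero_pow_four : walkExp n 0 (fun t => t ^ 4) = 3 * (n : ℝ) ^ 2 - 2 * n := by
  induction n with
  | zero => simp [walkExp_zero]
  | succ n ih =>
    have e : walkExp (n + 1) 0 (fun t => t ^ 4) =
        walkExp n 0 (fun t => t ^ 4) + 6 * walkExp n 0 (fun t => t ^ 2) + 1 := by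
      rw [walkExp_succ]
      simp only [add_zero, sub_zero, ← mul_add, ← walkExp_add, ← walkExp_const_mul]
      have e' : (fun t : ℝ => 1 / 2 * ((t + 1) ^ 4 + (t - 1) ^ 4)) =
          fun t => t ^ 4 + 6 * t ^ 2 + 1 := by ext t; ring
      rw [e', walkExp_add, walkExp_const]
    rw [e, ih, walkExp_sq]
    push_cast
    ring

/-- Exponential tilting of the biased walk into the symmetric one. -/
lemma walkExp_tilt (h0 : -1 < δ) (h1 : δ < 1) (φ : ℝ → ℝ) :
    walkExp n δ φ = √(1 - δ ^ 2) ^ n *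
      walkExp n 0 (fun t => Real.exp (Real.log ((1 + δ) / (1 - δ)) / 2 * t) * φ t) := by
  set l := Real.log ((1 + δ) / (1 - δ)) / 2 with hl
  have hp : 0 < 1 + δ := by linarith
  have hq : 0 < 1 - δ := by linarith
  have ep : √(1 - δ ^ 2) * Real.exp l = 1 + δ := by
    have : Real.exp l = √((1 + δ) / (1 - δ)) := by
      rw [Real.sqrt_eq_rpow, Real.rpow_def_of_pos (div_pos hp hq), hl]
      congr 1; ring
    rw [this, ← Real.sqrt_mul (by nlinarith), show (1 - δ ^ 2) * ((1 + δ) / (1 - δ)) =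
      (1 + δ) ^ 2 by field_simp; ring, Real.sqrt_sq hp.le]
  have eq : √(1 - δ ^ 2) * Real.exp (-l) = 1 - δ := by
    have h2 : √(1 - δ ^ 2) * √(1 - δ ^ 2) = (1 + δ) * (1 - δ) := by
      rw [Real.mul_self_sqrt (by nlinarith)]; ring
    rw [Real.exp_neg, ← div_eq_mul_inv, div_eq_iff (Real.exp_ne_zero _)]
    refine mul_left_cancel₀ hp.ne' ?_
    rw [← mul_assoc, ← h2]
    nth_rewrite 1 [← ep]
    ring
  have hw : ∀ c, signWeight δ c =
      √(1 - δ ^ 2) * (Real.exp (l * labelSign c) * signWeight 0 c) := by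
    intro c
    rw [← mul_assoc]
    fin_cases c
    · simp [signWeight, ep]; ring
    · simp [signWeight, eq]; ring
  unfold walkExp prodExp
  rw [Finset.mul_sum]
  refine Finset.sum_congr rfl fun x _ => ?_
  simp only [hw, Finset.prod_mul_distrib, Finset.prod_const, Finset.card_univ, Fintype.card_fin,
    Finset.mul_sum, Real.exp_sum]
  ring

lemma walkExp_negPart : walkExp n δ (fun t => max (-t) 0) =
    (walkExp n δ (fun t => |t|) - n * δ) / 2 := by
  rw [← walkExp_id, ← walkExp_sub, div_eq_inv_mul, ← walkExp_const_mul]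
  congr 1; ext t
  rcases le_total 0 t with h | h
  · rw [max_eq_right (by linarith), abs_of_nonneg h]; ring
  · rw [max_eq_left (by linarith), abs_of_nonpos h]; ring

lemma walkExp_negPart_nonneg (hδ : |δ| ≤ 1) : 0 ≤ walkExp n δ (fun t => max (-t) 0) := by
  have := walkExp_mono (n := n) hδ (φ := fun _ => 0) fun t => le_max_right (-t) 0
  rwa [walkExp_const] at this

lemma walkExp_abs_le (hδ : |δ| ≤ 1) : walkExp n δ (fun t => |t|) ≤ n := by
  rw [← walkExp_const (n := n) (δ := δ) n]
  refine prodExp_mono (fun _ c => signWeight_nonneg hδ c) fun x => ?_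
  exact (Finset.abs_sum_le_sum_abs _ _).trans (by simp)

/-- The second moment suffices, through |t| ≤ t²/(2n) + n/2. For n = 1 the walk always has absolute
value 1, hence the restriction on n. -/
lemma walkExp_abs_eq_iff (hn : 2 ≤ n) (h0 : 0 ≤ δ) (h1 : δ ≤ 1) :
    walkExp n δ (fun t => |t|) = n ↔ δ = 1 := by
  have hδ : |δ| ≤ 1 := abs_le.2 ⟨by linarith, h1⟩
  have hn' : (2 : ℝ) ≤ n := by exact_mod_cast hn
  constructor
  · intro h
    have hle : walkExp n δ (fun t => |t|) ≤ walkExp n δ (fun t => 1 / (2 * n) * t ^ 2 + n / 2) := by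
      refine walkExp_mono hδ fun t => ?_
      have : 0 ≤ (|t| - n) ^ 2 / (2 * n) := by positivity
      have e : (|t| - n) ^ 2 / (2 * n) = 1 / (2 * n) * t ^ 2 + n / 2 - |t| := by
        rw [← sq_abs t]; field_simp; ring
      linarith
    rw [h, walkExp_add, walkExp_const_mul, walkExp_const, walkExp_sq] at hle
    have e : 1 / (2 * (n : ℝ)) * (n * (1 - δ ^ 2) + (n * δ) ^ 2) = (1 - δ ^ 2 + n * δ ^ 2) / 2 := by
      field_simp
    rw [e] at hle
    by_contra hne
    have hlt : δ ^ 2 < 1 := by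
      have : δ < 1 := h1.lt_of_ne hne
      nlinarith
    nlinarith [mul_pos (by linarith : 0 < (n : ℝ) - 1) (sub_pos.2 hlt)]
  · rintro rfl
    refine le_antisymm (walkExp_abs_le hδ) ?_
    have := walkExp_mono (n := n) hδ (φ := fun t => t) (ψ := fun t => |t|) le_abs_self
    rw [walkExp_id] at this
    linarith

/-- The negative part is at most (u⁻) for the centred value u = t - nδ, and u⁻ is bounded by a
quadratic in u coming from (|u| - √n)² ≥ 0; then the variance is used. -/
lemma walkExp_negPart_le_sqrt (hn : 1 ≤ n) (h0 : 0 ≤ δ) (h1 : δ ≤ 1) :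
    walkExp n δ (fun t => max (-t) 0) ≤ √n / 2 := by
  have hδ : |δ| ≤ 1 := abs_le.2 ⟨by linarith, h1⟩
  have hn' : (0 : ℝ) < n := by exact_mod_cast hn
  set s := √(n : ℝ) with hs
  have hs0 : 0 < s := Real.sqrt_pos.2 hn'
  have hss : (n : ℝ) = s ^ 2 := (Real.sq_sqrt hn'.le).symm
  have hle : walkExp n δ (fun t => max (-t) 0) ≤ walkExp n δ (fun t =>
      1 / (4 * s) * t ^ 2 + (-(n * δ / (2 * s) + 1 / 2)) * t +
        ((n * δ) ^ 2 / (4 * s) + s / 4 + n * δ / 2)) := by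
    refine walkExp_mono hδ fun t => ?_
    have hnd : 0 ≤ n * δ := by positivity
    have e1 : 0 ≤ (|t - n * δ| - s) ^ 2 / (4 * s) := by positivity
    have e2 : (|t - n * δ| - s) ^ 2 / (4 * s) =
        (t - n * δ) ^ 2 / (4 * s) + s / 4 - |t - n * δ| / 2 := by
      rw [← sq_abs (t - n * δ)]; field_simp; ring
    have e3 : 1 / (4 * s) * t ^ 2 + (-(n * δ / (2 * s) + 1 / 2)) * t +
        ((n * δ) ^ 2 / (4 * s) + s / 4 + n * δ / 2) =
        (t - n * δ) ^ 2 / (4 * s) + s / 4 - (t - n * δ) / 2 := by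
      field_simp; ring
    rw [e3]
    refine max_le ?_ ?_
    · have := neg_le_abs (t - n * δ); linarith
    · have := le_abs_self (t - n * δ); linarith
  rw [walkExp_add, walkExp_const, walkExp_add, walkExp_const_mul, walkExp_const_mul, walkExp_sq,
    walkExp_id] at hle
  refine hle.trans ?_
  have e : 1 / (4 * s) * (n * (1 - δ ^ 2) + (n * δ) ^ 2) +
      (-(n * δ / (2 * s) + 1 / 2)) * (n * δ) + ((n * δ) ^ 2 / (4 * s) + s / 4 + n * δ / 2) =
      s / 2 - s * δ ^ 2 / 4 := by
    rw [hss]; field_simp; ring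
  rw [e]
  have : 0 ≤ s * δ ^ 2 := by positivity
  linarith

lemma sqrt_pow_eq_rpow {a : ℝ} (ha : 0 ≤ a) : √a ^ n = a ^ ((n : ℝ) / 2) := by
  rw [Real.sqrt_eq_rpow, ← Real.rpow_natCast, ← Real.rpow_mul ha]
  congr 1; ring

lemma log_ratio_eq (h0 : 0 ≤ δ) (h1 : δ < 1) :
    Real.log ((1 + δ) / (1 - δ)) = Real.log (1 + δ) - Real.log (1 - δ) :=
  Real.log_div (by linarith) (by linarith)

lemma log_one_sub_sq (h0 : 0 ≤ δ) (h1 : δ < 1) :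
    Real.log (1 - δ ^ 2) = Real.log (1 + δ) + Real.log (1 - δ) := by
  rw [← Real.log_mul (by linarith) (by linarith)]
  congr 1; ring

lemma le_log_ratio (h0 : 0 ≤ δ) (h1 : δ < 1) : δ ≤ Real.log ((1 + δ) / (1 - δ)) := by
  rw [log_ratio_eq h0 h1]
  have e1 := Real.log_nonneg (by linarith : 1 ≤ 1 + δ)
  have e2 := Real.log_le_sub_one_of_pos (by linarith : 0 < 1 - δ)
  linarith

/-- Uses t⁻ ≤ e^(-lt)/l, with l chosen so that the tilt cancels the exponential exactly and only the
normalizing factor remains. -/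
lemma walkExp_negPart_le_exp (h0 : 0 < δ) (h1 : δ < 1) :
    walkExp n δ (fun t => max (-t) 0) ≤
      (1 - δ ^ 2) ^ ((n : ℝ) / 2) / (Real.log ((1 + δ) / (1 - δ)) / 2) := by
  set l := Real.log ((1 + δ) / (1 - δ)) / 2 with hl
  have hl0 : 0 < l := by have := le_log_ratio h0.le h1; linarith
  have hle : walkExp n δ (fun t => max (-t) 0) ≤
      walkExp n δ (fun t => 1 / l * Real.exp (-(l * t))) := by
    refine walkExp_mono (abs_le.2 ⟨by linarith, h1.le⟩) fun t => ?_
    rw [one_div_mul_eq_div, le_div_iff₀ hl0]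
    rcases le_total 0 t with h | h
    · rw [max_eq_right (by linarith), zero_mul]; positivity
    · rw [max_eq_left (by linarith)]
      have := Real.add_one_le_exp (-(l * t))
      linarith
  refine hle.trans (le_of_eq ?_)
  rw [walkExp_const_mul, walkExp_tilt (by linarith) h1]
  simp only [← hl, ← Real.exp_add, add_neg_cancel, Real.exp_zero, walkExp_const]
  rw [sqrt_pow_eq_rpow (by nlinarith)]
  ring

/-- Lower bound for the truncated negative part of the symmetric walk. -/
lemma walkExp_zero_negPart_sub_sq_ge (hn : 1 ≤ n) :
    √n / 36 ≤ walkExp n 0 (fun t => max (-t) 0 - 1 / (4 * √n) * t ^ 2) := by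
  have hn' : (0 : ℝ) < n := by exact_mod_cast hn
  rw [walkExp_sub, walkExp_negPart, walkExp_const_mul, walkExp_sq]
  have habs : walkExp n 0 (fun t => 1 / √n * t ^ 2 - 4 / (27 * √n ^ 3) * t ^ 4) ≤
      walkExp n 0 (fun t => |t|) := by
    refine walkExp_mono (by simp) fun t => ?_
    set s := √(n : ℝ)
    have hs0 : 0 < s := Real.sqrt_pos.2 hn'
    -- The quartic minorant of |t| touches it at |t| = 3s/2; this double root determines the
    -- constant 4/27.
    have h : 0 ≤ |t| * (1 - 2 * |t| / (3 * s)) ^ 2 * (1 + |t| / (3 * s)) := by positivity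
    have e : |t| * (1 - 2 * |t| / (3 * s)) ^ 2 * (1 + |t| / (3 * s)) =
        |t| - (1 / s * t ^ 2 - 4 / (27 * s ^ 3) * t ^ 4) := by
      rw [show t ^ 4 = |t| ^ 4 by rw [Even.pow_abs (by decide)], ← sq_abs t]
      field_simp; ring
    linarith
  rw [walkExp_sub, walkExp_const_mul, walkExp_const_mul, walkExp_sq, walkExp_zero_pow_four] at habs
  set s := √(n : ℝ)
  have hs0 : 0 < s := Real.sqrt_pos.2 hn'
  have hss : (n : ℝ) = s ^ 2 := (Real.sq_sqrt hn'.le).symm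
  have e1 : 1 / s * (n * (1 - 0 ^ 2) + (n * 0) ^ 2) - 4 / (27 * s ^ 3) * (3 * (n : ℝ) ^ 2 - 2 * n) =
      5 / 9 * s + 8 / (27 * s) := by
    rw [hss]; field_simp; ring
  have e2 : 1 / (4 * s) * (n * (1 - 0 ^ 2) + (n * 0) ^ 2) = s / 4 := by
    rw [hss]; field_simp; ring
  have e3 : 0 ≤ 8 / (27 * s) := by positivity
  rw [e1] at habs
  rw [e2]
  -- The constant is (5/9)/2 - 1/4 = 1/36.
  linarith

lemma walkExp_negPart_ge (hn : 1 ≤ n) (h0 : 0 ≤ δ) (h1 : δ < 1) :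
    Real.exp ((n : ℝ) / 2 * Real.log (1 - δ ^ 2) - 2 * √n * Real.log ((1 + δ) / (1 - δ))) *
      (√n / 36) ≤ walkExp n δ (fun t => max (-t) 0) := by
  have hn' : (0 : ℝ) < n := by exact_mod_cast hn
  have hs0 : 0 < √(n : ℝ) := Real.sqrt_pos.2 hn'
  have hd : 0 < 1 - δ ^ 2 := by nlinarith
  have hl0 : 0 ≤ Real.log ((1 + δ) / (1 - δ)) := h0.trans (le_log_ratio h0 h1)
  rw [walkExp_tilt (by linarith) h1, sqrt_pow_eq_rpow hd.le, Real.rpow_def_of_pos hd,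
    sub_eq_add_neg, Real.exp_add, mul_assoc, mul_comm ((n : ℝ) / 2)]
  refine mul_le_mul_of_nonneg_left ?_ (Real.exp_nonneg _)
  refine (mul_le_mul_of_nonneg_left (walkExp_zero_negPart_sub_sq_ge hn)
    (Real.exp_nonneg _)).trans ?_
  rw [← walkExp_const_mul]
  refine walkExp_mono (by simp) fun t => ?_
  set s := √(n : ℝ)
  set l := Real.log ((1 + δ) / (1 - δ))
  have hm : 0 ≤ max (-t) 0 := le_max_right _ _
  have hsq : 0 ≤ 1 / (4 * s) * t ^ 2 := by positivity
  -- Beyond -4s the quadratic penalty exceeds the negative part, so the minorant is nonpositive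
  -- exactly where the exponential factor is not controlled.
  rcases le_total (-(4 * s)) t with h | h
  · have e1 : Real.exp (-(2 * s * l)) ≤ Real.exp (l / 2 * t) := by
      refine Real.exp_le_exp.2 ?_
      nlinarith
    exact (mul_le_mul_of_nonneg_left (by linarith) (Real.exp_nonneg _)).trans
      (mul_le_mul_of_nonneg_right e1 hm)
  · have e1 : max (-t) 0 - 1 / (4 * s) * t ^ 2 ≤ 0 := by
      rw [max_eq_left (by linarith), sub_nonpos, one_div_mul_eq_div, le_div_iff₀ (by positivity)]
      nlinarith
    exact (mul_nonpos_of_nonneg_of_nonpos (Real.exp_nonneg _) e1).trans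
      (mul_nonneg (Real.exp_nonneg _) hm)

/-- With a = -log(1-δ) and b = log(1+δ) ≤ δ, the claim is δ(a+b) ≤ 3.4(a-b). If a ≤ 2δ, use a - b ≥
δ² and a + b ≤ 3δ. If a ≥ 2δ, use b ≤ a/2 and δ < 1. -/
lemma mul_log_ratio_le (h0 : 0 ≤ δ) (h1 : δ < 1) :
    δ * Real.log ((1 + δ) / (1 - δ)) ≤ 3.4 * -Real.log (1 - δ ^ 2) := by
  have hsq : 0 < 1 - δ ^ 2 := by nlinarith
  have e0 := Real.log_le_sub_one_of_pos hsq
  rw [log_one_sub_sq h0 h1] at e0 ⊢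
  rw [log_ratio_eq h0 h1]
  have e1 := Real.log_le_sub_one_of_pos (by linarith : 0 < 1 + δ)
  set a := -Real.log (1 - δ) with ha
  set b := Real.log (1 + δ) with hb
  have ea : Real.log (1 - δ) = -a := by rw [ha, neg_neg]
  rw [ea] at e0 ⊢
  rcases le_total a (2 * δ) with h | h
  · nlinarith
  · nlinarith

/-- Here δ ≤ 1/5, and the linearized logarithms cost at most 25/12 + 9 < 12. -/
lemma small_drift_exponent_ge {s : ℝ} (hs : 10 ≤ s) (h0 : 0 ≤ δ) (h1 : s * δ ≤ 2) :
    -12 ≤ s ^ 2 / 2 * Real.log (1 - δ ^ 2) - 2 * s * Real.log ((1 + δ) / (1 - δ)) := by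
  have hδ : δ ≤ 1 / 5 := by nlinarith
  have hsq : 0 < 1 - δ ^ 2 := by nlinarith
  have e0 := Real.one_sub_inv_le_log_of_pos hsq
  have e1 := Real.log_le_sub_one_of_pos (by linarith : 0 < 1 + δ)
  have e2 := Real.one_sub_inv_le_log_of_pos (by linarith : 0 < 1 - δ)
  have f0 : (1 - δ ^ 2)⁻¹ ≤ 1 + 25 / 24 * δ ^ 2 := by
    rw [inv_le_iff_one_le_mul₀ hsq]
    nlinarith [sq_nonneg δ, mul_nonneg (sq_nonneg δ) (by nlinarith : 0 ≤ 1 / 25 - δ ^ 2)]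
  have f2 : (1 - δ)⁻¹ ≤ 1 + 5 / 4 * δ := by
    rw [inv_le_iff_one_le_mul₀ (by linarith)]
    nlinarith
  rw [log_ratio_eq h0 (by linarith)]
  have g0 : -(25 / 24 * δ ^ 2) ≤ Real.log (1 - δ ^ 2) := by linarith
  have g1 : Real.log (1 + δ) - Real.log (1 - δ) ≤ 9 / 4 * δ := by linarith
  have k0 := mul_le_mul_of_nonneg_left g0 (by positivity : 0 ≤ s ^ 2 / 2)
  have k1 := mul_le_mul_of_nonneg_left g1 (by positivity : 0 ≤ 2 * s)
  have k2 : (s * δ) ^ 2 ≤ 4 := by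
    have : 0 ≤ s * δ := by positivity
    nlinarith
  nlinarith

end walk

/-! ### Bounds on the gap between the two risks -/

namespace HMMParam

variable {𝕐 : Type*} [MeasurableSpace 𝕐] {L : Measure 𝕐} {θ : HMMParam 2 𝕐 L}

lemma two_mul_eps (hθ : θ.IsIndependent) {n : ℕ} (hn : 1 ≤ n) : 2 * θ.eps n = θ.meanContrast := by
  rw [eps, bayesClassRisk_eq hθ hn]; ring

lemma bayesClassRisk_sub_bayesClustRisk (hθ : θ.IsIndependent) {n : ℕ} (hn : 1 ≤ n) :
    θ.bayesClassRisk n - θ.bayesClustRisk n =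
      walkExp n θ.meanContrast (fun t => max (-t) 0) / n := by
  have hn' : (n : ℝ) ≠ 0 := by positivity
  rw [bayesClassRisk_eq hθ hn, bayesClustRisk_eq hθ hn, walkExp_negPart]
  field_simp
  ring

lemma bayesClassRisk_eq_zero_iff (hθ : θ.IsIndependent) {n : ℕ} (hn : 2 ≤ n) :
    θ.bayesClassRisk n = 0 ↔ θ.bayesClustRisk n = 0 := by
  have hn' : (0 : ℝ) < n := by positivity
  rw [bayesClassRisk_eq hθ (by lia), bayesClustRisk_eq hθ (by lia)]
  have key := walkExp_abs_eq_iff hn θ.meanContrast_nonneg θ.meanContrast_le_one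
  have e : 1 / 2 - 1 / (2 * (n : ℝ)) * walkExp n θ.meanContrast (fun t => |t|) = 0 ↔
      walkExp n θ.meanContrast (fun t => |t|) = n := by
    field_simp
    constructor <;> intro h <;> linarith
  rw [e, key]
  constructor <;> intro h <;> linarith

lemma risk_gap_le_sqrt (hθ : θ.IsIndependent) {n : ℕ} (hn : 1 ≤ n) :
    θ.bayesClassRisk n - θ.bayesClustRisk n ≤ √(Real.pi / (2 * (n : ℝ))) := by
  have hn' : (0 : ℝ) < n := by positivity
  rw [bayesClassRisk_sub_bayesClustRisk hθ hn]
  have h := div_le_div_of_nonneg_right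
    (walkExp_negPart_le_sqrt hn θ.meanContrast_nonneg θ.meanContrast_le_one) hn'.le
  refine h.trans (Real.le_sqrt_of_sq_le ?_)
  rw [div_pow, div_pow, Real.sq_sqrt hn'.le]
  have e : (n : ℝ) / 2 ^ 2 / n ^ 2 = 1 / 2 / (2 * n) := by field_simp
  rw [e]
  exact div_le_div_of_nonneg_right (by linarith [Real.pi_gt_three]) (by positivity)

lemma risk_gap_le_exp (hθ : θ.IsIndependent) {n : ℕ} (hn : 1 ≤ n)
    (h0 : 0 < θ.meanContrast) (h1 : θ.meanContrast < 1) :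
    θ.bayesClassRisk n - θ.bayesClustRisk n ≤ (1 - θ.meanContrast ^ 2) ^ ((n : ℝ) / 2) /
      ((n : ℝ) / 2 * Real.log ((1 + θ.meanContrast) / (1 - θ.meanContrast))) := by
  have hn' : (0 : ℝ) < n := by positivity
  rw [bayesClassRisk_sub_bayesClustRisk hθ hn]
  refine (div_le_div_of_nonneg_right (walkExp_negPart_le_exp h0 h1) hn'.le).trans (le_of_eq ?_)
  rw [div_div]
  congr 1; ring

lemma risk_gap_nonneg (hθ : θ.IsIndependent) {n : ℕ} (hn : 1 ≤ n) :
    0 ≤ θ.bayesClassRisk n - θ.bayesClustRisk n := by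
  rw [bayesClassRisk_sub_bayesClustRisk hθ hn]
  exact div_nonneg (walkExp_negPart_nonneg
    (abs_le.2 ⟨by linarith [θ.meanContrast_nonneg], θ.meanContrast_le_one⟩)) (by positivity)

lemma risk_gap_ge (hθ : θ.IsIndependent) {n : ℕ} (hn : 1 ≤ n) (h1 : θ.meanContrast < 1) :
    Real.exp ((n : ℝ) / 2 * Real.log (1 - θ.meanContrast ^ 2) -
        2 * √n * Real.log ((1 + θ.meanContrast) / (1 - θ.meanContrast))) / 36 * (1 / √n) ≤
      θ.bayesClassRisk n - θ.bayesClustRisk n := by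
  have hn' : (0 : ℝ) < n := by positivity
  rw [bayesClassRisk_sub_bayesClustRisk hθ hn]
  refine le_trans (le_of_eq ?_)
    (div_le_div_of_nonneg_right (walkExp_negPart_ge hn θ.meanContrast_nonneg h1) hn'.le)
  have hs0 : 0 < √(n : ℝ) := Real.sqrt_pos.2 hn'
  have e : 1 / √(n : ℝ) = √n / n := by
    rw [div_eq_div_iff hs0.ne' hn'.ne', one_mul, Real.mul_self_sqrt hn'.le]
  rw [e]
  ring

lemma risk_gap_ge_of_small (hθ : θ.IsIndependent) {n : ℕ} (hn : 100 ≤ n)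
    (h : √n * θ.meanContrast ≤ 2) :
    Real.exp (-12) / 36 * (1 / √n) ≤ θ.bayesClassRisk n - θ.bayesClustRisk n := by
  have hs : 10 ≤ √(n : ℝ) := by
    rw [Real.le_sqrt (by norm_num) (by positivity)]
    norm_num; exact_mod_cast hn
  have h1 : θ.meanContrast < 1 := by nlinarith [θ.meanContrast_nonneg]
  refine le_trans ?_ (risk_gap_ge hθ (by lia) h1)
  have := small_drift_exponent_ge hs θ.meanContrast_nonneg h
  rw [Real.sq_sqrt (by positivity)] at this
  gcongr

lemma risk_gap_ge_of_large (hθ : θ.IsIndependent) {n : ℕ} (hn : 1 ≤ n)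
    (h : 2 ≤ √n * θ.meanContrast) (h1 : θ.meanContrast < 1) :
    1 / 36 * ((1 - θ.meanContrast ^ 2) ^
        ((n : ℝ) / 2 * (1 + 6.8 / (√n * (θ.meanContrast / 2)))) /
      ((n : ℝ) / 2 * Real.log ((1 + θ.meanContrast) / (1 - θ.meanContrast)))) ≤
      θ.bayesClassRisk n - θ.bayesClustRisk n := by
  have hn' : (0 : ℝ) < n := by positivity
  have hs0 : 0 < √(n : ℝ) := Real.sqrt_pos.2 hn'
  have hss : (n : ℝ) = √n ^ 2 := (Real.sq_sqrt hn'.le).symm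
  have hδ : 0 < θ.meanContrast := by
    by_contra hc
    nlinarith
  refine le_trans ?_ (risk_gap_ge hθ hn h1)
  set δ := θ.meanContrast
  set l := Real.log ((1 + δ) / (1 - δ))
  have hsq : 0 < 1 - δ ^ 2 := by nlinarith
  have key : δ * l ≤ 3.4 * -Real.log (1 - δ ^ 2) := mul_log_ratio_le hδ.le h1
  -- This lets 1/√n be replaced by the smaller reciprocal of the denominator in the claim.
  have hden : √n ≤ (n : ℝ) / 2 * l := by
    have e1 : δ ≤ l := le_log_ratio hδ.le h1
    have e2 : (n : ℝ) / 2 * δ ≤ n / 2 * l := mul_le_mul_of_nonneg_left e1 (by positivity)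
    refine le_trans ?_ e2
    nlinarith
  -- The correction in the exponent is 6.8√n/δ, and 6.8 = 2 · 3.4 is the truncation cost 2√n l after
  -- `mul_log_ratio_le`.
  have hexp : Real.log (1 - δ ^ 2) * ((n : ℝ) / 2 * (1 + 6.8 / (√n * (δ / 2)))) ≤
      (n : ℝ) / 2 * Real.log (1 - δ ^ 2) - 2 * √n * l := by
    have e : (n : ℝ) / 2 * (1 + 6.8 / (√n * (δ / 2))) = n / 2 + 6.8 * √n / δ := by
      nth_rewrite 1 3 [hss]
      field_simp
    have e3 : l ≤ 3.4 * -Real.log (1 - δ ^ 2) / δ := by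
      rw [le_div_iff₀ hδ]; linarith
    have e4 := mul_le_mul_of_nonneg_left e3 (by positivity : 0 ≤ 2 * √(n : ℝ))
    rw [e]
    have e5 : 2 * √(n : ℝ) * (3.4 * -Real.log (1 - δ ^ 2) / δ) =
        -(Real.log (1 - δ ^ 2) * (6.8 * √n / δ)) := by
      field_simp; ring
    rw [e5] at e4
    linarith
  rw [Real.rpow_def_of_pos hsq, div_mul_div_comm, div_mul_div_comm]
  rw [one_mul, mul_one]
  gcongr

end HMMParam

theorem theorem5 :
    (∀ (𝕐 : Type u) [TopologicalSpace 𝕐] [PolishSpace 𝕐] [MeasurableSpace 𝕐] [BorelSpace 𝕐]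
        (L : Measure 𝕐) (θ : HMMParam 2 𝕐 L), θ.IsIndependent → ∀ n : ℕ,
      (2 ≤ n → (θ.bayesClassRisk n = 0 ↔ θ.bayesClustRisk n = 0)) ∧
      (1 ≤ n → θ.bayesClassRisk n ≠ 0 →
        (θ.eps n = 0 →
          θ.bayesClassRisk n - θ.bayesClustRisk n ≤ √(Real.pi / (2 * (n : ℝ)))) ∧
        (θ.eps n ≠ 0 →
          θ.bayesClassRisk n - θ.bayesClustRisk n ≤
            min
              ((1 - 4 * θ.eps n ^ 2) ^ ((n : ℝ) / 2) /
                ((n : ℝ) / 2 * Real.log ((1 + 2 * θ.eps n) / (1 - 2 * θ.eps n))))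
              (√(Real.pi / (2 * (n : ℝ))))))) ∧
    (∃ B : ℝ, 0 < B ∧
      ∀ (𝕐 : Type u) [TopologicalSpace 𝕐] [PolishSpace 𝕐] [MeasurableSpace 𝕐] [BorelSpace 𝕐]
        (L : Measure 𝕐) (θ : HMMParam 2 𝕐 L), θ.IsIndependent → ∀ n : ℕ, 100 ≤ n →
        (θ.eps n = 0 →
          B * (1 / √(n : ℝ)) ≤ θ.bayesClassRisk n - θ.bayesClustRisk n) ∧
        (θ.eps n ≠ 0 →
          B * min
              ((1 - 4 * θ.eps n ^ 2) ^
                  ((n : ℝ) / 2 * (1 + 6.8 / max 1 (√(n : ℝ) * θ.eps n))) /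
                ((n : ℝ) / 2 * Real.log ((1 + 2 * θ.eps n) / (1 - 2 * θ.eps n))))
              (1 / √(n : ℝ)) ≤
            θ.bayesClassRisk n - θ.bayesClustRisk n)) := by
  refine ⟨fun 𝕐 _ _ _ _ L θ hθ n => ⟨HMMParam.bayesClassRisk_eq_zero_iff hθ, fun hn hR =>
    ⟨fun _ => HMMParam.risk_gap_le_sqrt hθ hn, fun hε =>
      le_min ?_ (HMMParam.risk_gap_le_sqrt hθ hn)⟩⟩,
    Real.exp (-12) / 36, by positivity, fun 𝕐 _ _ _ _ L θ hθ n hn => ⟨fun hε => ?_, fun hε => ?_⟩⟩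
  · have he := HMMParam.two_mul_eps hθ hn
    have h4 : 4 * θ.eps n ^ 2 = θ.meanContrast ^ 2 := by rw [← he]; ring
    rw [h4, he]
    refine HMMParam.risk_gap_le_exp hθ hn
      (θ.meanContrast_nonneg.lt_of_ne fun h => hε (by linarith))
      (θ.meanContrast_le_one.lt_of_ne fun h => hR ?_)
    rw [HMMParam.bayesClassRisk_eq hθ hn, h]; norm_num
  · have he := HMMParam.two_mul_eps hθ (by lia : 1 ≤ n)
    refine HMMParam.risk_gap_ge_of_small hθ hn ?_
    rw [← he, hε]; norm_num
  · have he := HMMParam.two_mul_eps hθ (by lia : 1 ≤ n)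
    have h4 : 4 * θ.eps n ^ 2 = θ.meanContrast ^ 2 := by rw [← he]; ring
    have he' : θ.eps n = θ.meanContrast / 2 := by linarith
    have hB : Real.exp (-12) / 36 ≤ 1 / 36 := by
      have : Real.exp (-12) ≤ 1 := Real.exp_le_one_iff.2 (by norm_num)
      linarith
    rcases θ.meanContrast_le_one.eq_or_lt with h1 | h1
    -- At ε = 1/2 the conventions 2/0 = 0, log 0 = 0 and division by 0 make the quotient 0, as
    -- intended.
    · have hlog : Real.log ((1 + 2 * θ.eps n) / (1 - 2 * θ.eps n)) = 0 := by
        rw [he, h1]; norm_num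
      rw [hlog, mul_zero, div_zero, min_eq_left (by positivity), mul_zero]
      exact HMMParam.risk_gap_nonneg hθ (by lia)
    -- The threshold 2 is √n ε = 1, where the maximum in the exponent switches.
    rcases le_total (√(n : ℝ) * θ.meanContrast) 2 with h | h
    · exact (mul_le_mul_of_nonneg_left (min_le_right _ _) (by positivity)).trans
        (HMMParam.risk_gap_ge_of_small hθ hn h)
    · refine le_trans ?_ (HMMParam.risk_gap_ge_of_large hθ (by lia) h h1)
      rw [h4, he, he', max_eq_right (by linarith)]
      refine mul_le_mul hB (min_le_left _ _) (le_min ?_ (by positivity)) (by norm_num)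
      have hl := θ.meanContrast_nonneg.trans (le_log_ratio θ.meanContrast_nonneg h1)
      have hsq : 0 ≤ 1 - θ.meanContrast ^ 2 := by nlinarith [θ.meanContrast_nonneg]
      positivity
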